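/- Let $\Delta$ be a thick irreducible spherical building of rank at least $2$ with simply laced Coxeter diagram $\Pi$. Let $J$ be its polar type, that is, the set of nodes of $\Pi$ whose simple root is not perpendicular to the highest root. The long root subgroup geometry $\Gamma=(X,\mathcal L)$ of $\Delta$ has as point set $X$ the set of simplices of type $J$ of $\Delta$, and each panel of cotype $i\in J$ determines a line, namely the set of all points incident with that panel. Such a line corresponds to the simplex contained in the panel whose type consists of $J\setminus\{i\}$ together with the nodes of $\Pi$ adjacent to $i$. Two points, respectively two lines, are called opposite if the corresponding simplices of $\Delta$ are opposite, that is, if they have opposite types and are contained in opposite chambers. Let $\theta$ be a collineation of $\Gamma$, that is, a permutation of $X$ preserving $\mathcal L$. Suppose that $\theta$ is point-domestic and line-domestic: no point of $\Gamma$ is mapped to an opposite point and no line of $\Gamma$ is mapped to an opposite line. Then $\theta$ is a $\{1,2'\}$-kangaroo. That is, for every point $x\in X$, the points $x$ and $x^\theta$ are neither distinct and collinear (distance $1$), nor special, that is, distinct and not collinear with a unique point collinear to both (distance $2'$). -/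

import Mathlib

namespace LongRoot

/-! ## Point-line geometries

A point-line geometry is given by its set `𝓛` of lines, each line being a set of points. -/

section PointLine

variable {X : Type*}

/-- `p` and `q` are distinct points on a common line. -/
def Collinear (𝓛 : Set (Set X)) (p q : X) : Prop :=
  p ≠ q ∧ ∃ L ∈ 𝓛, p ∈ L ∧ q ∈ L

/-- The graph on the points in which distinct collinear points are adjacent. -/
def collinearityGraph (𝓛 : Set (Set X)) : SimpleGraph X where
  Adj := Collinear 𝓛
  symm := ⟨fun _ _ h => ⟨h.1.symm, h.2.imp fun _ hL => ⟨hL.1, hL.2.2, hL.2.1⟩⟩⟩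
  loopless := ⟨fun _ h => h.1 rfl⟩

/-- A set of points containing each line that meets it in at least two points. -/
def IsSubspace (𝓛 : Set (Set X)) (S : Set X) : Prop :=
  ∀ L ∈ 𝓛, (L ∩ S).Nontrivial → L ⊆ S

/-- A subspace whose points are pairwise collinear. -/
def IsSingular (𝓛 : Set (Set X)) (S : Set X) : Prop :=
  IsSubspace 𝓛 S ∧ S.Pairwise (Collinear 𝓛)

/-- A subspace containing all points of each shortest path (in the collinearity graph)
between two of its points. -/
def IsConvexSubspace (𝓛 : Set (Set X)) (S : Set X) : Prop :=
  IsSubspace 𝓛 S ∧ ∀ p ∈ S, ∀ q ∈ S, ∀ w : (collinearityGraph 𝓛).Walk p q,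
    w.length = (collinearityGraph 𝓛).dist p q → ∀ x ∈ w.support, x ∈ S

/-- Polar spaces of (finite) rank at least 2, axiomatized by the Buekenhout-Shult one-or-all
axiom. -/
structure IsPolarSpace (𝓛 : Set (Set X)) : Prop where
  exists_line : 𝓛.Nonempty
  three_points : ∀ L ∈ 𝓛, 3 ≤ L.encard
  one_or_all : ∀ p, ∀ L ∈ 𝓛,
    (∀ x ∈ L, x = p ∨ Collinear 𝓛 p x) ∨ (∃! x, x ∈ L ∧ (x = p ∨ Collinear 𝓛 p x))
  nondegenerate : ∀ p, ∃ q, q ≠ p ∧ ¬ Collinear 𝓛 p q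
  finite_rank : ∀ c : Set (Set X), (∀ S ∈ c, IsSingular 𝓛 S) → IsChain (· ⊆ ·) c → c.Finite

/-- The lines contained in `S`, as lines of a geometry with point set `S`. -/
def inducedLines (𝓛 : Set (Set X)) (S : Set X) : Set (Set S) :=
  {L | Subtype.val '' L ∈ 𝓛}

/-- A convex subspace that is a polar space of rank at least 2. -/
def IsSymplecton (𝓛 : Set (Set X)) (S : Set X) : Prop :=
  IsConvexSubspace 𝓛 S ∧ IsPolarSpace (inducedLines 𝓛 S)

/-- The five possible mutual positions `0, 1, 2, 2', 3` of two points of a long root subgroup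
geometry. -/
inductive Position
  | zero
  | one
  | two
  | twoPrime
  | three

/-- `HasPosition 𝓛 d p q`: the points `p` and `q` have mutual position `d`. -/
def HasPosition (𝓛 : Set (Set X)) : Position → X → X → Prop
  | .zero, p, q => p = q
  | .one, p, q => Collinear 𝓛 p q
  | .two, p, q => p ≠ q ∧ ¬ Collinear 𝓛 p q ∧ ∃ S, IsSymplecton 𝓛 S ∧ p ∈ S ∧ q ∈ S
  | .twoPrime, p, q =>
      p ≠ q ∧ ¬ Collinear 𝓛 p q ∧ ∃! r, Collinear 𝓛 p r ∧ Collinear 𝓛 q r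
  | .three, p, q => (collinearityGraph 𝓛).dist p q = 3

/-- A permutation of the points that preserves the set of lines. -/
def IsCollineation (𝓛 : Set (Set X)) (θ : Equiv.Perm X) : Prop :=
  ∀ L : Set X, θ '' L ∈ 𝓛 ↔ L ∈ 𝓛

/-- `θ` skips the mutual positions in `D`. -/
def IsKangaroo (𝓛 : Set (Set X)) (D : Set Position) (θ : Equiv.Perm X) : Prop :=
  ∀ x, ∀ d ∈ D, ¬ HasPosition 𝓛 d x (θ x)

end PointLine

/-! ## Coxeter matrices and the polar type -/

section Coxeter

variable {B : Type*} (M : CoxeterMatrix B)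

/-- The Coxeter diagram has no multiple bonds. -/
def IsSimplyLaced : Prop :=
  ∀ i j, i ≠ j → M i j = 2 ∨ M i j = 3

/-- The Coxeter diagram is connected (and nonempty). -/
def IsIrreducible : Prop :=
  Nonempty B ∧ ∀ K : Set B, K.Nonempty → Kᶜ.Nonempty → ∃ i ∈ K, ∃ j ∈ Kᶜ, M i j ≠ 2

/-- The element of maximal length of a finite Coxeter group. -/
def IsLongest (w : M.Group) : Prop :=
  ∀ v, M.toCoxeterSystem.length v ≤ M.toCoxeterSystem.length w

variable [Fintype B] [DecidableEq B]

/-- The Cartan matrix of a simply laced Coxeter matrix. -/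
def cartan (i j : B) : ℤ :=
  if i = j then 2 else if M i j = 2 then 0 else -1

/-- The pairing of `v = ∑ j, v j • α_j` with the simple coroot of `α_i`. It is also the inner
product of `v` and `α_i`, as all roots have squared length 2. -/
def pairing (v : B → ℤ) (i : B) : ℤ :=
  ∑ j, v j * cartan M j i

/-- The roots, in coordinates with respect to the simple roots: the images of the simple roots
under products of simple reflections. -/
inductive IsRoot : (B → ℤ) → Prop
  | simple (i : B) : IsRoot (Pi.single i 1)
  | reflect (i : B) (v : B → ℤ) : IsRoot v → IsRoot (v - pairing M v i • Pi.single i 1)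

/-- The root all of whose coordinates are maximal. -/
def IsHighestRoot (h : B → ℤ) : Prop :=
  IsRoot M h ∧ ∀ v, IsRoot M v → v ≤ h

/-- The set of simple roots not perpendicular to the highest root. -/
def polarType : Set B :=
  {i | ∃ h, IsHighestRoot M h ∧ pairing M h i ≠ 0}

/-- The type of the simplices corresponding to the lines that are determined by the panels of
cotype `i`, where `i` is in the polar type: the remaining polar nodes and the nodes adjacent to
`i`. Each panel of cotype `i` contains exactly one simplex of this type, and this is the smallest
face of the panel that is incident with the same points. -/
def lineType (i : B) : Set B :=
  (polarType M \ {i}) ∪ {k | k ≠ i ∧ M i k ≠ 2}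

end Coxeter

/-! ## Buildings -/

/-- A building of type `M` with chamber set `Δ`, given by its Weyl distance. -/
structure Building {B : Type*} (M : CoxeterMatrix B) (Δ : Type*) where
  δ : Δ → Δ → M.Group
  δ_eq_one_iff : ∀ C D, δ C D = 1 ↔ C = D
  δ_of_adjacent : ∀ C D C' i, δ C' C = M.simple i →
    δ C' D = M.simple i * δ C D ∨ δ C' D = δ C D
  δ_of_length_lt : ∀ C D C' i, δ C' C = M.simple i →
    M.toCoxeterSystem.length (M.simple i * δ C D) = M.toCoxeterSystem.length (δ C D) + 1 →
    δ C' D = M.simple i * δ C D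
  exists_adjacent : ∀ C D i, ∃ C', δ C' C = M.simple i ∧ δ C' D = M.simple i * δ C D

namespace Building

variable {B Δ : Type*} {M : CoxeterMatrix B} (𝔅 : Building M Δ)

/-- Each panel is contained in at least three chambers. -/
def IsThick : Prop :=
  ∀ C i, ∃ D E, D ≠ E ∧ 𝔅.δ C D = M.simple i ∧ 𝔅.δ C E = M.simple i

/-- The residue of type `K` containing the chamber `C`. -/
def residue (K : Set B) (C : Δ) : Set Δ :=
  {D | 𝔅.δ C D ∈ Subgroup.closure (M.simple '' K)}

/-- The simplices of type `J`. A simplex is identified with the set of chambers containing it,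
which is a residue of cotype `J`. -/
def Simplex (J : Set B) : Type _ :=
  {R : Set Δ // ∃ C, R = 𝔅.residue Jᶜ C}

variable {𝔅}

/-- Two simplices are incident if some chamber contains both. -/
def Incident {J K : Set B} (F : 𝔅.Simplex J) (G : 𝔅.Simplex K) : Prop :=
  (F.1 ∩ G.1).Nonempty

/-- Two simplices are opposite if they have opposite types and are contained in opposite
chambers. -/
def Opposite {J K : Set B} (F : 𝔅.Simplex J) (G : 𝔅.Simplex K) : Prop :=
  ∃ w₀, IsLongest M w₀ ∧ K = {k | ∃ j ∈ J, M.simple k = w₀ * M.simple j * w₀⁻¹} ∧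
    ∃ C ∈ F.1, ∃ D ∈ G.1, 𝔅.δ C D = w₀

/-- The set of simplices of type `J` incident with `F`. -/
def shadow (J : Set B) {K : Set B} (F : 𝔅.Simplex K) : Set (𝔅.Simplex J) :=
  {p | Incident p F}

variable [Fintype B] [DecidableEq B] (𝔅)

/-- The points of the long root subgroup geometry: the simplices of polar type. -/
abbrev Point : Type _ := 𝔅.Simplex (polarType M)

/-- The lines of the long root subgroup geometry: the sets of points incident with a panel whose
cotype is in the polar type. -/
def lines : Set (Set 𝔅.Point) :=
  {L | ∃ i ∈ polarType M, ∃ P : 𝔅.Simplex {i}ᶜ, L = shadow (polarType M) P}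

variable {𝔅}

/-- Two lines are opposite if the simplices corresponding to them are opposite. -/
def OppositeLines (L L' : Set 𝔅.Point) : Prop :=
  ∃ i ∈ polarType M, ∃ j ∈ polarType M,
    ∃ (F : 𝔅.Simplex (lineType M i)) (G : 𝔅.Simplex (lineType M j)),
      shadow (polarType M) F = L ∧ shadow (polarType M) G = L' ∧ Opposite F G

/-- `θ` maps no point to an opposite point. -/
def IsPointDomestic (θ : Equiv.Perm 𝔅.Point) : Prop :=
  ∀ x, ¬ Opposite x (θ x)

/-- `θ` maps no line to an opposite line. -/
def IsLineDomestic (θ : Equiv.Perm 𝔅.Point) : Prop :=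
  ∀ L ∈ 𝔅.lines, ¬ OppositeLines L (θ '' L)

end Building

end LongRoot

/-! Everything is computed with roots. Write h for the highest root. From a chamber C, a point y is
seen as the root `pointRoot C y`, the image of h under the Weyl distance from C to any chamber of y.
For C in x, the inner product of this root with h is `pos x y`; its values 2, 1, 0, -1, -2 are the
mutual positions from equal to opposite. Counting common neighbours recovers the position from
collinearity, so collineations preserve it (`pos_map`).

Two facts carry the argument. By thickness (`exists_simpleRoot_pair`), if x is special to θx, hence
also to θ⁻¹x, then some chamber C of x sees θx and θ⁻¹x as α_i - h and α_j - h with i and j polar;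
if x is collinear with θx, it sees them as α_i and α_j. By `eq_of_pos_lt`, at most one point of a
line has a position to a given point z above the least position to z on that line.

Let L be the line of the i-panel of C. Special case (`pos_ne_neg_one`): if i = j, then L and θL are
opposite. If i ≠ j, some e ≠ x on L has θe at position at least 0 from x. A third point y of L is
opposite θx, not opposite θe, and by domesticity not opposite θy, so θL has two exceptional points
with respect to y.

Collinear case (`pos_ne_one`): by now every point is at position at least 0 from its image. If i =
j, a point of L other than x would go to an opposite point. If i ≠ j, the one-exception property
applied on L and then on θL identifies the images of two distinct points. -/

namespace LongRoot

/-! ### The root lattice and the reflection representation -/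

section Form

variable {B : Type*} [Fintype B] [DecidableEq B] (M : CoxeterMatrix B)

/-- The simple root `α_i`, in coordinates with respect to the simple roots. -/
abbrev simpleRoot (i : B) : B → ℤ := Pi.single i 1

/-- The symmetric bilinear form on the root lattice given by the Cartan matrix. -/
def form : LinearMap.BilinForm ℤ (B → ℤ) := Matrix.toBilin' (Matrix.of (cartan M))

variable {M}

theorem form_simpleRoot (i j : B) : form M (simpleRoot i) (simpleRoot j) = cartan M i j := by
  simp [form, Matrix.toBilin'_single]

omit [Fintype B] in
theorem cartan_comm (i j : B) : cartan M i j = cartan M j i := by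
  simp only [cartan, M.symmetric i j, eq_comm (a := i)]

theorem form_expand_right (u v : B → ℤ) :
    form M u v = ∑ i, v i * form M u (simpleRoot i) := by
  conv_lhs => rw [← Finset.univ_sum_single v]
  rw [map_sum]
  refine Finset.sum_congr rfl fun i _ => ?_
  have : Pi.single i (v i) = v i • simpleRoot i := by
    rw [simpleRoot, ← Pi.single_smul]; simp
  rw [this, map_smul, smul_eq_mul]

theorem form_comm (u v : B → ℤ) : form M u v = form M v u := by
  simp only [form, Matrix.toBilin'_apply, Matrix.of_apply]
  rw [Finset.sum_comm]
  refine Finset.sum_congr rfl fun i _ => Finset.sum_congr rfl fun j _ => ?_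
  rw [cartan_comm]; ring

theorem pairing_eq_form (v : B → ℤ) (i : B) : pairing M v i = form M v (simpleRoot i) := by
  rw [form_comm, form_expand_right, pairing]
  refine Finset.sum_congr rfl fun j _ => ?_
  rw [form_simpleRoot, cartan_comm]

theorem form_simpleRoot_self (i : B) : form M (simpleRoot i) (simpleRoot i) = 2 := by
  simp [form_simpleRoot, cartan]

theorem form_simpleRoot_of_eq_two {i j : B} (hij : i ≠ j) (h : M i j = 2) :
    form M (simpleRoot i) (simpleRoot j) = 0 := by
  simp [form_simpleRoot, cartan, hij, h]

theorem form_simpleRoot_of_ne_two {i j : B} (hij : i ≠ j) (h : M i j ≠ 2) :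
    form M (simpleRoot i) (simpleRoot j) = -1 := by
  simp [form_simpleRoot, cartan, hij, h]

theorem form_simpleRoot_nonpos {i j : B} (hij : i ≠ j) :
    form M (simpleRoot i) (simpleRoot j) ≤ 0 := by
  by_cases h : M i j = 2
  · rw [form_simpleRoot_of_eq_two hij h]
  · rw [form_simpleRoot_of_ne_two hij h]; norm_num

variable (M) in
/-- The simple reflection on the root lattice. -/
def simpleReflection (i : B) : Module.End ℤ (B → ℤ) :=
  1 - ((form M).flip (simpleRoot i)).smulRight (simpleRoot i)

theorem simpleReflection_apply (i : B) (v : B → ℤ) :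
    simpleReflection M i v = v - form M v (simpleRoot i) • simpleRoot i := by
  simp [simpleReflection]

theorem isLiftable_simpleReflection (hsl : IsSimplyLaced M) :
    M.IsLiftable (simpleReflection M) := by
  intro i j
  have hi := form_simpleRoot_self (M := M) i
  have hj := form_simpleRoot_self (M := M) j
  refine LinearMap.ext fun v => ?_
  by_cases hij : i = j
  · subst hij
    simp only [M.diagonal, pow_one, Module.End.mul_apply, simpleReflection_apply, map_sub, map_smul,
      hi, Module.End.one_apply]
    module
  rcases hsl i j hij with h | h
  · have h1 := form_simpleRoot_of_eq_two hij h
    have h2 := form_simpleRoot_of_eq_two (Ne.symm hij) (M.symmetric i j ▸ h)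
    simp only [h, pow_two, Module.End.mul_apply, simpleReflection_apply, map_sub, map_smul,
      hi, hj, h1, h2, Module.End.one_apply]
    module
  · have h1 := form_simpleRoot_of_ne_two hij (by rw [h]; decide)
    have h2 := form_simpleRoot_of_ne_two (Ne.symm hij) (by rw [← M.symmetric i j, h]; decide)
    simp only [h, pow_succ, pow_zero, one_mul, Module.End.mul_apply, simpleReflection_apply,
      map_sub, map_smul, hi, hj, h1, h2, Module.End.one_apply]
    module

/-- The reflection representation of a simply laced Coxeter group on the root lattice. -/
def rep (hsl : IsSimplyLaced M) : M.Group →* Module.End ℤ (B → ℤ) :=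
  M.toCoxeterSystem.lift ⟨simpleReflection M, isLiftable_simpleReflection hsl⟩

variable (hsl : IsSimplyLaced M)

theorem rep_simple (i : B) (v : B → ℤ) :
    rep hsl (M.simple i) v = v - form M v (simpleRoot i) • simpleRoot i := by
  rw [← simpleReflection_apply, ← M.toCoxeterSystem_simple, rep, CoxeterSystem.lift_apply_simple]

theorem rep_mul (w w' : M.Group) (v : B → ℤ) : rep hsl (w * w') v = rep hsl w (rep hsl w' v) := by
  rw [map_mul, Module.End.mul_apply]

@[simp] theorem rep_one (v : B → ℤ) : rep hsl 1 v = v := by simp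

@[simp] theorem rep_inv_rep (w : M.Group) (v : B → ℤ) : rep hsl w⁻¹ (rep hsl w v) = v := by
  rw [← rep_mul, inv_mul_cancel, rep_one]

@[simp] theorem rep_rep_inv (w : M.Group) (v : B → ℤ) : rep hsl w (rep hsl w⁻¹ v) = v := by
  rw [← rep_mul, mul_inv_cancel, rep_one]

theorem rep_simple_self (i : B) : rep hsl (M.simple i) (simpleRoot i) = -simpleRoot i := by
  rw [rep_simple, form_simpleRoot_self]; module

theorem form_rep (w : M.Group) (u v : B → ℤ) :
    form M (rep hsl w u) (rep hsl w v) = form M u v := by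
  induction w using M.toCoxeterSystem.simple_induction_left generalizing u v with
  | one => simp
  | mul_simple_left w i ih =>
    rw [M.toCoxeterSystem_simple, rep_mul, rep_mul, rep_simple, rep_simple, ← ih u v]
    simp only [map_sub, map_smul, LinearMap.sub_apply, LinearMap.smul_apply,
      form_simpleRoot_self, smul_eq_mul, form_comm (simpleRoot i)]
    ring

theorem form_rep_left (w : M.Group) (u v : B → ℤ) :
    form M (rep hsl w u) v = form M u (rep hsl w⁻¹ v) := by
  rw [← form_rep hsl w u, rep_rep_inv]

end Form

/-! ### The length function -/

section Length

variable {B : Type*} {M : CoxeterMatrix B}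

/-- The length function of the Coxeter group. -/
noncomputable abbrev len (w : M.Group) : ℕ := M.toCoxeterSystem.length w

theorem simple_mul_simple_cancel (i : B) (w : M.Group) : M.simple i * (M.simple i * w) = w :=
  M.toCoxeterSystem.simple_mul_simple_cancel_left i

theorem mul_simple_mul_simple_cancel (i : B) (w : M.Group) : w * M.simple i * M.simple i = w :=
  M.toCoxeterSystem.simple_mul_simple_cancel_right i

theorem simple_inv (i : B) : (M.simple i)⁻¹ = M.simple i := M.toCoxeterSystem.inv_simple i

theorem len_mul_simple (w : M.Group) (i : B) :
    len (w * M.simple i) = len w + 1 ∨ len (w * M.simple i) + 1 = len w :=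
  M.toCoxeterSystem.length_mul_simple w i

theorem len_simple_mul (w : M.Group) (i : B) :
    len (M.simple i * w) = len w + 1 ∨ len (M.simple i * w) + 1 = len w :=
  M.toCoxeterSystem.length_simple_mul w i

theorem len_inv (w : M.Group) : len w⁻¹ = len w := M.toCoxeterSystem.length_inv w

theorem len_eq_zero_iff (w : M.Group) : len w = 0 ↔ w = 1 := M.toCoxeterSystem.length_eq_zero_iff

theorem exists_len_mul_simple_lt {w : M.Group} (hw : w ≠ 1) : ∃ i, len (w * M.simple i) < len w :=
  M.toCoxeterSystem.exists_rightDescent_of_ne_one hw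

theorem exists_len_simple_mul_lt {w : M.Group} (hw : w ≠ 1) : ∃ i, len (M.simple i * w) < len w :=
  M.toCoxeterSystem.exists_leftDescent_of_ne_one hw

theorem simple_comm_of_eq_two {i j : B} (h : M i j = 2) :
    M.simple i * M.simple j = M.simple j * M.simple i := by
  have := M.toCoxeterSystem.simple_mul_simple_pow i j
  rw [h, pow_two, M.toCoxeterSystem_simple, mul_eq_one_iff_eq_inv, mul_inv_rev, simple_inv,
    simple_inv] at this
  exact this

theorem simple_braid_of_eq_three {i j : B} (h : M i j = 3) :
    M.simple i * M.simple j * M.simple i = M.simple j * M.simple i * M.simple j := by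
  have := M.toCoxeterSystem.simple_mul_simple_pow i j
  rw [h, M.toCoxeterSystem_simple] at this
  have h2 : (M.simple i * M.simple j * M.simple i) * (M.simple j * M.simple i * M.simple j) = 1 := by
    rw [← this, pow_three']; simp only [mul_assoc]
  rw [mul_eq_one_iff_eq_inv] at h2
  rwa [mul_inv_rev, mul_inv_rev, simple_inv, simple_inv, ← mul_assoc] at h2

end Length

/-! ### Length and the sign of roots -/

section Positivity

variable {B : Type*} [Fintype B] [DecidableEq B] {M : CoxeterMatrix B} (hsl : IsSimplyLaced M)

/-- Induction on the length: split off a right descent, w = v s_j, and compute inside the dihedral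
group of i and j, where the bond is 2 or 3. Then w α_i is v α_i, or v α_i + v α_j, or u α_j for a
shorter u. -/
theorem rep_simpleRoot_nonneg {w : M.Group} {i : B} (h : len w < len (w * M.simple i)) :
    0 ≤ rep hsl w (simpleRoot i) := by
  induction hn : len w using Nat.strong_induction_on generalizing w i with
  | _ n ih =>
  subst hn
  have hpos : ∀ j : B, (0 : B → ℤ) ≤ simpleRoot j := fun j => Pi.single_nonneg.2 zero_le_one
  by_cases hw : w = 1
  · subst hw; simp
  obtain ⟨j, hj⟩ := exists_len_mul_simple_lt hw
  have hij : i ≠ j := by rintro rfl; omega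
  obtain ⟨v, rfl⟩ : ∃ v, w = v * M.simple j :=
    ⟨w * M.simple j, (mul_simple_mul_simple_cancel j w).symm⟩
  rw [mul_simple_mul_simple_cancel] at hj
  have hji := len_mul_simple (v * M.simple j) i
  have hvj := len_mul_simple v j
  have hvi := len_mul_simple v i
  rcases hsl i j hij with hm | hm
  · have hc : v * M.simple j * M.simple i = v * M.simple i * M.simple j := by
      rw [mul_assoc, ← simple_comm_of_eq_two hm, mul_assoc]
    have := len_mul_simple (v * M.simple i) j
    rw [hc] at h hji
    rw [rep_mul, rep_simple, form_simpleRoot_of_eq_two hij hm, zero_smul, sub_zero]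
    exact ih _ hj (by omega) rfl
  · have hn := form_simpleRoot_of_ne_two hij (by rw [hm]; decide)
    have hn' := form_simpleRoot_of_ne_two hij.symm (by rw [← M.symmetric i j, hm]; decide)
    by_cases hlt : len v < len (v * M.simple i)
    · rw [rep_mul, rep_simple, hn, map_sub, map_smul]
      have h1 := ih _ hj hlt rfl
      have h2 := ih _ hj (i := j) (by omega) rfl
      have : rep hsl v (simpleRoot i) - (-1 : ℤ) • rep hsl v (simpleRoot j) =
        rep hsl v (simpleRoot i) + rep hsl v (simpleRoot j) := by module
      rw [this]; exact add_nonneg h1 h2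
    · obtain ⟨u, rfl⟩ : ∃ u, v = u * M.simple i :=
        ⟨v * M.simple i, (mul_simple_mul_simple_cancel i v).symm⟩
      rw [mul_simple_mul_simple_cancel] at hvi hlt
      -- Here w s_i has length `len u + 3` and equals u s_j s_i s_j, which forces s_j to lengthen u;
      -- moreover s_i s_j α_i = α_j.
      have hb : u * M.simple i * M.simple j * M.simple i =
          u * M.simple j * M.simple i * M.simple j := by
        rw [mul_assoc, mul_assoc, ← mul_assoc (M.simple i), simple_braid_of_eq_three hm]
        simp only [mul_assoc]
      rw [hb] at h hji
      have h1 := len_mul_simple u j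
      have h2 := len_mul_simple (u * M.simple j) i
      have h3 := len_mul_simple (u * M.simple j * M.simple i) j
      have key : rep hsl (u * M.simple i * M.simple j) (simpleRoot i) =
          rep hsl u (simpleRoot j) := by
        rw [rep_mul, rep_mul, rep_simple hsl j, hn, map_sub, map_smul, rep_simple_self,
          rep_simple hsl i, hn']
        congr 1; module
      rw [key]
      exact ih _ (by omega) (by omega) rfl

theorem rep_simpleRoot_nonpos {w : M.Group} {i : B} (h : len (w * M.simple i) < len w) :
    rep hsl w (simpleRoot i) ≤ 0 := by
  have := rep_simpleRoot_nonneg hsl (w := w * M.simple i) (i := i)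
    (by rwa [mul_simple_mul_simple_cancel])
  rwa [rep_mul, rep_simple_self, map_neg, neg_nonneg] at this

theorem rep_simpleRoot_ne_zero (w : M.Group) (i : B) : rep hsl w (simpleRoot i) ≠ 0 := by
  intro h
  have := form_rep hsl w (simpleRoot i) (simpleRoot i)
  rw [h, form_simpleRoot_self] at this
  simp at this

theorem len_lt_len_mul_simple {w : M.Group} {i : B} (h : ¬ rep hsl w (simpleRoot i) ≤ 0) :
    len w < len (w * M.simple i) := by
  by_contra hlt
  have := len_mul_simple w i
  exact h (rep_simpleRoot_nonpos hsl (by omega))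

theorem len_mul_simple_lt_len {w : M.Group} {i : B} (h : ¬ 0 ≤ rep hsl w (simpleRoot i)) :
    len (w * M.simple i) < len w := by
  by_contra hlt
  have := len_mul_simple w i
  exact h (rep_simpleRoot_nonneg hsl (by omega))

omit [Fintype B] [DecidableEq B] in
theorem len_simple_mul_eq (w : M.Group) (i : B) :
    len (M.simple i * w) = len (w⁻¹ * M.simple i) := by
  rw [← len_inv, mul_inv_rev, simple_inv]

theorem eq_one_of_rep_nonneg {w : M.Group} (h : ∀ i, 0 ≤ rep hsl w (simpleRoot i)) : w = 1 := by
  by_contra hw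
  obtain ⟨i, hi⟩ := exists_len_mul_simple_lt hw
  exact rep_simpleRoot_ne_zero hsl w i (le_antisymm (rep_simpleRoot_nonpos hsl hi) (h i))

theorem rep_injective : Function.Injective (rep hsl) := by
  rw [injective_iff_map_eq_one]
  intro w hw
  refine eq_one_of_rep_nonneg hsl fun i => ?_
  rw [hw]
  exact Pi.single_nonneg.2 zero_le_one

theorem isRoot_iff {v : B → ℤ} : IsRoot M v ↔ ∃ w i, v = rep hsl w (simpleRoot i) := by
  constructor
  · intro h
    induction h with
    | simple i => exact ⟨1, i, by simp⟩
    | reflect i v _ ih =>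
      obtain ⟨w, j, rfl⟩ := ih
      exact ⟨M.simple i * w, j, by rw [rep_mul, rep_simple, pairing_eq_form]⟩
  · rintro ⟨w, i, rfl⟩
    induction w using M.toCoxeterSystem.simple_induction_left with
    | one => exact (rep_one hsl (simpleRoot i)).symm ▸ IsRoot.simple i
    | mul_simple_left w j ih =>
      rw [M.toCoxeterSystem_simple, rep_mul, rep_simple, ← pairing_eq_form]
      exact IsRoot.reflect j _ ih

theorem isRoot_simpleRoot (i : B) : IsRoot M (simpleRoot i) := IsRoot.simple i

theorem IsRoot.rep {v : B → ℤ} (h : IsRoot M v) (w : M.Group) : IsRoot M (rep hsl w v) := by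
  obtain ⟨w', i, rfl⟩ := (isRoot_iff hsl).1 h
  exact (isRoot_iff hsl).2 ⟨w * w', i, by rw [rep_mul]⟩

include hsl in
theorem IsRoot.neg {v : B → ℤ} (h : IsRoot M v) : IsRoot M (-v) := by
  obtain ⟨w, i, rfl⟩ := (isRoot_iff hsl).1 h
  exact (isRoot_iff hsl).2 ⟨w * M.simple i, i, by rw [rep_mul, rep_simple_self, map_neg]⟩

include hsl in
theorem IsRoot.form_self {v : B → ℤ} (h : IsRoot M v) : form M v v = 2 := by
  obtain ⟨w, i, rfl⟩ := (isRoot_iff hsl).1 h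
  rw [form_rep, form_simpleRoot_self]

include hsl in
theorem IsRoot.nonneg_or_nonpos {v : B → ℤ} (h : IsRoot M v) : 0 ≤ v ∨ v ≤ 0 := by
  obtain ⟨w, i, rfl⟩ := (isRoot_iff hsl).1 h
  by_contra! hc
  exact absurd (len_lt_len_mul_simple hsl hc.2) (len_mul_simple_lt_len hsl hc.1).not_gt

include hsl in
theorem IsRoot.sub_form_smul {u v : B → ℤ} (hu : IsRoot M u) (hv : IsRoot M v) :
    IsRoot M (u - form M u v • v) := by
  obtain ⟨w, i, rfl⟩ := (isRoot_iff hsl).1 hv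
  have : u - form M u (LongRoot.rep hsl w (simpleRoot i)) • LongRoot.rep hsl w (simpleRoot i) =
      LongRoot.rep hsl w (LongRoot.rep hsl (M.simple i) (LongRoot.rep hsl w⁻¹ u)) := by
    rw [rep_simple, map_sub, rep_rep_inv, map_smul, form_rep_left, inv_inv]
  rw [this]
  exact ((hu.rep hsl _).rep hsl _).rep hsl _

end Positivity

/-! ### The highest root, the polar nodes and the longest element -/

section HighestRoot

variable {B : Type*} [Fintype B] [DecidableEq B]

/-- A connected simply laced Coxeter matrix, together with its highest root. -/
structure HighestRootDatum (M : CoxeterMatrix B) where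
  simplyLaced : IsSimplyLaced M
  irreducible : IsIrreducible M
  h : B → ℤ
  isHighest : IsHighestRoot M h

namespace HighestRootDatum

variable {M : CoxeterMatrix B} (R : HighestRootDatum M)

theorem isRoot : IsRoot M R.h := R.isHighest.1

theorem le_h {v : B → ℤ} (hv : IsRoot M v) : v ≤ R.h := R.isHighest.2 v hv

theorem neg_h_le {v : B → ℤ} (hv : IsRoot M v) : -R.h ≤ v :=
  neg_le.1 (R.le_h (hv.neg R.simplyLaced))

theorem form_h_self : form M R.h R.h = 2 := R.isRoot.form_self R.simplyLaced

theorem form_h_simpleRoot_nonneg (i : B) : 0 ≤ form M R.h (simpleRoot i) := by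
  have h1 := R.le_h (IsRoot.reflect i _ R.isRoot) i
  rw [pairing_eq_form] at h1
  simpa using h1

theorem form_h_nonneg {v : B → ℤ} (hv : 0 ≤ v) : 0 ≤ form M R.h v := by
  rw [form_expand_right]
  exact Finset.sum_nonneg fun i _ => mul_nonneg (hv i) (R.form_h_simpleRoot_nonneg i)

theorem nonneg_of_form_h_pos {v : B → ℤ} (hv : IsRoot M v) (h : 0 < form M R.h v) : 0 ≤ v := by
  refine (hv.nonneg_or_nonpos R.simplyLaced).resolve_right fun h' => ?_
  have := R.form_h_nonneg (neg_nonneg.2 h')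
  rw [map_neg] at this
  omega

theorem form_h_le_two {v : B → ℤ} (hv : IsRoot M v) : form M R.h v ≤ 2 := by
  have := R.form_h_nonneg (sub_nonneg.2 (R.le_h hv))
  rw [map_sub, R.form_h_self] at this
  linarith

/-- The reflection in h sends v to the root v - 2h, which is at least -h; hence v ≥ h. -/
theorem eq_h_of_form_eq_two {v : B → ℤ} (hv : IsRoot M v) (h : form M R.h v = 2) : v = R.h := by
  refine le_antisymm (R.le_h hv) ?_
  have h1 := R.neg_h_le (hv.sub_form_smul R.simplyLaced R.isRoot)
  rw [form_comm, h] at h1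
  intro i
  have := h1 i
  simp only [Pi.neg_apply, Pi.sub_apply, Pi.smul_apply, smul_eq_mul] at this
  linarith

theorem rep_simple_rep_simple_simpleRoot {i j : B} (hij : i ≠ j) (h : M i j ≠ 2) :
    rep R.simplyLaced (M.simple i) (rep R.simplyLaced (M.simple j) (simpleRoot i)) =
      simpleRoot j := by
  rw [rep_simple _ j, form_simpleRoot_of_ne_two hij h, map_sub, map_smul, rep_simple_self,
    rep_simple, form_comm, form_simpleRoot_of_ne_two hij h]
  module

/-- The orbit of h contains some simple root, adjacent simple roots are conjugate, and the diagram
is connected. Transitivity on roots lets bounds proved for h pass to all pairs of roots. -/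
theorem exists_rep_h_eq_simpleRoot (i : B) : ∃ w, simpleRoot i = rep R.simplyLaced w R.h := by
  by_contra hi
  obtain ⟨w, j, hj⟩ := (isRoot_iff R.simplyLaced).1 R.isRoot
  obtain ⟨k, ⟨u, hu⟩, l, hl, hkl⟩ := R.irreducible.2
    {i | ∃ w, simpleRoot i = rep R.simplyLaced w R.h} ⟨j, w⁻¹, by rw [hj, rep_inv_rep]⟩ ⟨i, hi⟩
  have hne : k ≠ l := by rintro rfl; exact hl ⟨u, hu⟩
  refine hl ⟨M.simple k * M.simple l * u, ?_⟩
  rw [rep_mul, rep_mul, ← hu, R.rep_simple_rep_simple_simpleRoot hne hkl]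

theorem exists_rep_h_eq {v : B → ℤ} (hv : IsRoot M v) : ∃ w, v = rep R.simplyLaced w R.h := by
  obtain ⟨w, i, rfl⟩ := (isRoot_iff R.simplyLaced).1 hv
  obtain ⟨u, hu⟩ := R.exists_rep_h_eq_simpleRoot i
  exact ⟨w * u, by rw [rep_mul, hu]⟩

include R

theorem form_le_two {u v : B → ℤ} (hu : IsRoot M u) (hv : IsRoot M v) : form M u v ≤ 2 := by
  obtain ⟨w, rfl⟩ := R.exists_rep_h_eq hu
  rw [form_rep_left]
  exact R.form_h_le_two (hv.rep _ _)

theorem eq_of_form_eq_two {u v : B → ℤ} (hu : IsRoot M u) (hv : IsRoot M v)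
    (h : form M u v = 2) : u = v := by
  obtain ⟨w, rfl⟩ := R.exists_rep_h_eq hu
  rw [form_rep_left] at h
  rw [← R.eq_h_of_form_eq_two (hv.rep _ _) h, rep_rep_inv]

theorem neg_two_le_form {u v : B → ℤ} (hu : IsRoot M u) (hv : IsRoot M v) : -2 ≤ form M u v := by
  have := R.form_le_two (hu.neg R.simplyLaced) hv
  rw [map_neg, LinearMap.neg_apply] at this
  linarith

theorem eq_neg_of_form_eq_neg_two {u v : B → ℤ} (hu : IsRoot M u) (hv : IsRoot M v)
    (h : form M u v = -2) : v = -u := by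
  refine (R.eq_of_form_eq_two (hu.neg R.simplyLaced) hv ?_).symm
  rw [map_neg, LinearMap.neg_apply, h]; norm_num

theorem isRoot_sub {u v : B → ℤ} (hu : IsRoot M u) (hv : IsRoot M v)
    (h : form M u v = 1) : IsRoot M (u - v) := by
  simpa [h] using hu.sub_form_smul R.simplyLaced hv

theorem isRoot_add {u v : B → ℤ} (hu : IsRoot M u) (hv : IsRoot M v)
    (h : form M u v = -1) : IsRoot M (u + v) := by
  simpa [h] using hu.sub_form_smul R.simplyLaced hv

theorem one_le_h (i : B) : 1 ≤ R.h i := by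
  simpa using R.le_h (isRoot_simpleRoot i) i

/-- The value 2 would make α_i the highest root, but h has full support and the rank is at least 2.
-/
theorem form_h_simpleRoot_eq [Nontrivial B] (i : B) :
    form M R.h (simpleRoot i) = 0 ∨ form M R.h (simpleRoot i) = 1 := by
  have h0 := R.form_h_simpleRoot_nonneg i
  have h2 := R.form_h_le_two (isRoot_simpleRoot i)
  have : form M R.h (simpleRoot i) ≠ 2 := by
    intro h
    have hi := R.eq_h_of_form_eq_two (isRoot_simpleRoot i) h
    obtain ⟨j, hj⟩ := exists_ne i
    have := R.one_le_h j
    simp [← hi, Pi.single_eq_of_ne hj] at this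
  omega

theorem mem_polarType [Nontrivial B] {i : B} :
    i ∈ polarType M ↔ form M R.h (simpleRoot i) = 1 := by
  constructor
  · rintro ⟨h', hh', hne⟩
    obtain rfl : h' = R.h := le_antisymm (R.le_h hh'.1) (hh'.2 _ R.isRoot)
    rw [pairing_eq_form] at hne
    exact (R.form_h_simpleRoot_eq i).resolve_left hne
  · intro h
    exact ⟨R.h, R.isHighest, by rw [pairing_eq_form, h]; norm_num⟩

theorem notMem_polarType [Nontrivial B] {i : B} :
    i ∉ polarType M ↔ form M R.h (simpleRoot i) = 0 := by
  rw [R.mem_polarType]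
  have := R.form_h_simpleRoot_eq i
  omega

/-- A root of degree one in the polar nodes that is antidominant for the other nodes is simple. -/
theorem exists_eq_simpleRoot [Nontrivial B] {v : B → ℤ} (hv : IsRoot M v)
    (h1 : form M R.h v = 1) (hk : ∀ k, k ∉ polarType M → form M v (simpleRoot k) ≤ 0) :
    ∃ i ∈ polarType M, v = simpleRoot i := by
  have hv0 : 0 ≤ v := R.nonneg_of_form_h_pos hv (by rw [h1]; norm_num)
  rw [form_expand_right] at h1
  obtain ⟨i, -, hi⟩ := Finset.exists_ne_zero_of_sum_ne_zero (h1.trans_ne one_ne_zero)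
  have hiJ : i ∈ polarType M := by
    by_contra h
    rw [R.notMem_polarType.1 h, mul_zero] at hi
    exact hi rfl
  have hnn : ∀ k, 0 ≤ v k * form M R.h (simpleRoot k) := fun k =>
    mul_nonneg (hv0 k) (R.form_h_simpleRoot_nonneg k)
  have hsum := Finset.add_sum_erase Finset.univ
    (fun k => v k * form M R.h (simpleRoot k)) (Finset.mem_univ i)
  have hrest : 0 ≤ ∑ k ∈ Finset.univ.erase i, v k * form M R.h (simpleRoot k) :=
    Finset.sum_nonneg fun k _ => hnn k
  have hpos : 0 < v i * form M R.h (simpleRoot i) := lt_of_le_of_ne (hnn i) hi.symm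
  rw [h1] at hsum
  have hvi : v i = 1 := by
    have : v i * form M R.h (simpleRoot i) = 1 := by linarith
    rwa [R.mem_polarType.1 hiJ, mul_one] at this
  have hother : ∀ k, k ≠ i → k ∈ polarType M → v k = 0 := by
    intro k hki hkJ
    have h0 : ∑ k ∈ Finset.univ.erase i, v k * form M R.h (simpleRoot k) = 0 := by
      simp only [hvi, R.mem_polarType.1 hiJ] at hsum
      linarith
    have := (Finset.sum_eq_zero_iff_of_nonneg fun k _ => hnn k).1 h0 k
      (Finset.mem_erase.2 ⟨hki, Finset.mem_univ k⟩)
    rwa [R.mem_polarType.1 hkJ, mul_one] at this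
  refine ⟨i, hiJ, R.eq_of_form_eq_two hv (isRoot_simpleRoot i) (le_antisymm
    (R.form_le_two hv (isRoot_simpleRoot i)) ?_)⟩
  -- In the expansion of (v, v) = 2 the other polar coefficients vanish and the nonpolar terms are
  -- nonpositive, so (v, α_i) ≥ 2.
  have h2 := hv.form_self R.simplyLaced
  rw [form_expand_right, ← Finset.add_sum_erase _ _ (Finset.mem_univ i), hvi, one_mul] at h2
  have : ∑ k ∈ Finset.univ.erase i, v k * form M v (simpleRoot k) ≤ 0 := by
    refine Finset.sum_nonpos fun k hk' => ?_
    by_cases hkJ : k ∈ polarType M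
    · rw [hother k (Finset.ne_of_mem_erase hk') hkJ, zero_mul]
    · exact mul_nonpos_of_nonneg_of_nonpos (hv0 k) (hk k hkJ)
  linarith

/-- The stabilizer of a dominant vector is generated by the simple reflections fixing it. -/
theorem mem_closure_of_rep_eq {x : B → ℤ} (hx : ∀ k, 0 ≤ form M x (simpleRoot k)) {w : M.Group}
    (hw : rep R.simplyLaced w x = x) :
    w ∈ Subgroup.closure (M.simple '' {k | form M x (simpleRoot k) = 0}) := by
  induction hn : len w using Nat.strong_induction_on generalizing w with
  | _ n ih =>
  subst hn
  by_cases h1 : w = 1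
  · rw [h1]; exact one_mem _
  obtain ⟨i, hi⟩ := exists_len_mul_simple_lt h1
  have hneg := rep_simpleRoot_nonpos R.simplyLaced hi
  -- At a descent i, dominance gives 0 ≤ (x, α_i) = (wx, wα_i) = (x, wα_i) ≤ 0.
  have h0 : form M x (simpleRoot i) = 0 := by
    refine le_antisymm ?_ (hx i)
    rw [← form_rep R.simplyLaced w, hw, form_expand_right]
    exact Finset.sum_nonpos fun k _ => mul_nonpos_of_nonpos_of_nonneg (hneg k) (hx k)
  have hw' : rep R.simplyLaced (w * M.simple i) x = x := by
    rw [rep_mul, rep_simple, h0, zero_smul, sub_zero, hw]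
  have := Subgroup.mul_mem _ (ih _ hi hw' rfl)
    (Subgroup.subset_closure (Set.mem_image_of_mem M.simple h0))
  rwa [mul_simple_mul_simple_cancel] at this

theorem rep_h_of_mem_closure [Nontrivial B] {w : M.Group}
    (hw : w ∈ Subgroup.closure (M.simple '' (polarType M)ᶜ)) : rep R.simplyLaced w R.h = R.h := by
  induction hw using Subgroup.closure_induction with
  | mem _ hx =>
    obtain ⟨k, hk, rfl⟩ := hx
    rw [rep_simple, R.notMem_polarType.1 hk, zero_smul, sub_zero]
  | one => simp
  | mul _ _ _ _ h1 h2 => rw [rep_mul, h2, h1]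
  | inv x _ h => rw [← h, rep_inv_rep, h]

theorem mem_closure_of_rep_h [Nontrivial B] {w : M.Group} (hw : rep R.simplyLaced w R.h = R.h) :
    w ∈ Subgroup.closure (M.simple '' (polarType M)ᶜ) := by
  have := R.mem_closure_of_rep_eq R.form_h_simpleRoot_nonneg hw
  rwa [show {k | form M R.h (simpleRoot k) = 0} = (polarType M)ᶜ from
    Set.ext fun k => R.notMem_polarType.symm] at this

/-- The vector 3h - α_j is fixed by w and dominant, and its zero nodes are those required. The
factor 3 keeps all polar nodes strictly positive: at j itself, 2h - α_j would give 0. -/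
theorem mem_closure_of_rep_h_of_rep_simpleRoot [Nontrivial B] {w : M.Group} {j : B}
    (hj : j ∈ polarType M) (hw : rep R.simplyLaced w R.h = R.h)
    (hwj : rep R.simplyLaced w (simpleRoot j) = simpleRoot j) :
    w ∈ Subgroup.closure
      (M.simple '' {k | k ∉ polarType M ∧ form M (simpleRoot j) (simpleRoot k) = 0}) := by
  have hform : ∀ k, form M ((3 : ℤ) • R.h - simpleRoot j) (simpleRoot k) =
      3 * form M R.h (simpleRoot k) - form M (simpleRoot j) (simpleRoot k) := fun k => by
    rw [map_sub, map_smul, LinearMap.sub_apply, LinearMap.smul_apply, smul_eq_mul]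
  have h2 : ∀ k, form M (simpleRoot j) (simpleRoot k) ≤ 2 := fun k =>
    R.form_le_two (isRoot_simpleRoot j) (isRoot_simpleRoot k)
  have hneg : ∀ k, k ∉ polarType M → form M (simpleRoot j) (simpleRoot k) ≤ 0 := fun k hk =>
    form_simpleRoot_nonpos fun h => hk (h ▸ hj)
  have key : ∀ k, 0 ≤ form M ((3 : ℤ) • R.h - simpleRoot j) (simpleRoot k) ∧
      (form M ((3 : ℤ) • R.h - simpleRoot j) (simpleRoot k) = 0 ↔
        k ∉ polarType M ∧ form M (simpleRoot j) (simpleRoot k) = 0) := by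
    intro k
    rw [hform]
    by_cases hk : k ∈ polarType M
    · have := h2 k
      rw [R.mem_polarType.1 hk]
      simp only [hk, not_true_eq_false, false_and, iff_false]
      omega
    · have := hneg k hk
      rw [R.notMem_polarType.1 hk]
      simp only [hk, not_false_eq_true, true_and]
      omega
  have := R.mem_closure_of_rep_eq (x := (3 : ℤ) • R.h - simpleRoot j) (fun k => (key k).1)
    (w := w) (by rw [map_sub, map_smul, hw, hwj])
  rwa [show {k | form M ((3 : ℤ) • R.h - simpleRoot j) (simpleRoot k) = 0} =
    {k | k ∉ polarType M ∧ form M (simpleRoot j) (simpleRoot k) = 0} from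
    Set.ext fun k => (key k).2] at this

omit R in
theorem rep_expand (hsl : IsSimplyLaced M) (w : M.Group) (v : B → ℤ) :
    rep hsl w v = ∑ i, v i • rep hsl w (simpleRoot i) := by
  conv_lhs => rw [← Finset.univ_sum_single v]
  rw [map_sum]
  refine Finset.sum_congr rfl fun i _ => ?_
  rw [← map_smul, simpleRoot, ← Pi.single_smul]; simp

omit [Fintype B] [DecidableEq B] R in
theorem _root_.LongRoot.IsLongest.inv {w : M.Group} (hw : IsLongest M w) : IsLongest M w⁻¹ := fun v =>
  (hw v).trans_eq (len_inv w).symm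

theorem rep_longest_simpleRoot_nonpos {w : M.Group} (hw : IsLongest M w) (i : B) :
    rep R.simplyLaced w (simpleRoot i) ≤ 0 := by
  apply rep_simpleRoot_nonpos
  have h1 : len (w * M.simple i) ≤ len w := hw _
  have := len_mul_simple w i
  omega

theorem rep_longest_nonpos {w : M.Group} (hw : IsLongest M w) {v : B → ℤ} (hv : 0 ≤ v) :
    rep R.simplyLaced w v ≤ 0 := by
  rw [rep_expand]
  refine Finset.sum_nonpos fun i _ => ?_
  intro k
  exact mul_nonpos_of_nonneg_of_nonpos (hv i) (R.rep_longest_simpleRoot_nonpos hw i k)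

/-- The longest element reverses the order, so applying w to w⁻¹(-h) ≤ h gives wh ≤ -h; the other
inequality holds for every root. -/
theorem rep_longest_h {w : M.Group} (hw : IsLongest M w) : rep R.simplyLaced w R.h = -R.h := by
  refine le_antisymm ?_ (R.neg_h_le (R.isRoot.rep _ _))
  have hroot := (R.isRoot.neg R.simplyLaced).rep R.simplyLaced w⁻¹
  have := R.rep_longest_nonpos hw (sub_nonneg.2 (R.le_h hroot))
  rw [map_sub, rep_rep_inv] at this
  intro i
  have := this i
  simp only [Pi.sub_apply, Pi.neg_apply, Pi.zero_apply] at this ⊢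
  linarith

/-- For k in the support of β = -wα_i, applying w⁻¹ to β - α_k ≥ 0 yields -α_i ≤ w⁻¹α_k ≤ 0. A
nonzero integral vector in this range is -α_i. -/
theorem exists_rep_longest_simpleRoot {w : M.Group} (hw : IsLongest M w) (i : B) :
    ∃ k, rep R.simplyLaced w (simpleRoot i) = -simpleRoot k := by
  set β : B → ℤ := -rep R.simplyLaced w (simpleRoot i) with hβ
  have hβ0 : 0 ≤ β := neg_nonneg.2 (R.rep_longest_simpleRoot_nonpos hw i)
  obtain ⟨k, hk⟩ : ∃ k, β k ≠ 0 := by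
    by_contra! h
    exact rep_simpleRoot_ne_zero R.simplyLaced w i (neg_eq_zero.1 (funext h))
  have hk1 : 1 ≤ β k := by have := hβ0 k; simp only [Pi.zero_apply] at this; omega
  have hw' := hw.inv
  have hle : 0 ≤ β - simpleRoot k := by
    intro l
    by_cases hl : l = k
    · subst hl; simpa using hk1
    · simpa [Pi.single_eq_of_ne hl] using hβ0 l
  have hγ := R.rep_longest_nonpos hw' hle
  have hγ0 := R.rep_longest_simpleRoot_nonpos hw' k
  rw [map_sub, hβ, map_neg, rep_inv_rep] at hγ
  refine ⟨k, ?_⟩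
  have heq : rep R.simplyLaced w⁻¹ (simpleRoot k) = -simpleRoot i := by
    have hne := rep_simpleRoot_ne_zero R.simplyLaced w⁻¹ k
    have hoff : ∀ l, l ≠ i → rep R.simplyLaced w⁻¹ (simpleRoot k) l = 0 := by
      intro l hl
      have h1 := hγ l
      have h2 := hγ0 l
      simp only [Pi.sub_apply, Pi.neg_apply, Pi.zero_apply, simpleRoot,
        Pi.single_eq_of_ne hl] at h1 h2 ⊢
      omega
    have hi : rep R.simplyLaced w⁻¹ (simpleRoot k) i ≠ 0 := by
      intro h
      refine hne (funext fun l => ?_)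
      by_cases hl : l = i
      · rw [hl, h]; rfl
      · exact hoff l hl
    funext l
    by_cases hl : l = i
    · subst hl
      have h1 := hγ l
      have h2 := hγ0 l
      simp only [Pi.sub_apply, Pi.neg_apply, Pi.zero_apply, simpleRoot, Pi.single_eq_same]
        at h1 h2 hi ⊢
      omega
    · rw [hoff l hl]; simp [Pi.single_eq_of_ne hl]
  rw [← rep_rep_inv R.simplyLaced w (simpleRoot k), heq, map_neg, neg_neg]

theorem conj_simple_of_rep {w : M.Group} {i k : B}
    (h : rep R.simplyLaced w (simpleRoot i) = -simpleRoot k) :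
    w * M.simple i * w⁻¹ = M.simple k := by
  apply rep_injective R.simplyLaced
  refine LinearMap.ext fun v => ?_
  rw [rep_mul, rep_mul, rep_simple, rep_simple, map_sub, rep_rep_inv, map_smul, form_rep_left,
    inv_inv, h, map_neg]
  module

theorem simple_injective : Function.Injective M.simple := by
  intro k l h
  by_contra hkl
  have : rep R.simplyLaced (M.simple k) (simpleRoot k) k =
    rep R.simplyLaced (M.simple l) (simpleRoot k) k := by rw [h]
  rw [rep_simple_self, rep_simple] at this
  simp [Pi.single_eq_of_ne hkl] at this

/-- A set of nodes described by a property invariant under opposition has the opposite type. -/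
theorem opposite_type {w : M.Group} (hw : IsLongest M w) {P Q : B → Prop}
    (h : ∀ l k, rep R.simplyLaced w (simpleRoot l) = -simpleRoot k → (P l ↔ Q k)) :
    {k | Q k} = {k | ∃ l ∈ {l | P l}, M.simple k = w * M.simple l * w⁻¹} := by
  ext k
  constructor
  · intro hk
    obtain ⟨l, hl⟩ := R.exists_rep_longest_simpleRoot hw.inv k
    have hl' : rep R.simplyLaced w (simpleRoot l) = -simpleRoot k := by
      rw [← neg_neg (simpleRoot l), ← hl, map_neg, rep_rep_inv]
    exact ⟨l, (h l k hl').2 hk, (R.conj_simple_of_rep hl').symm⟩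
  · rintro ⟨l, hl, hk⟩
    obtain ⟨k', hk'⟩ := R.exists_rep_longest_simpleRoot hw l
    rw [R.conj_simple_of_rep hk'] at hk
    obtain rfl := R.simple_injective hk
    exact (h l k hk').1 hl

theorem opposite_polarType [Nontrivial B] {w : M.Group} (hw : IsLongest M w) :
    polarType M = {k | ∃ l ∈ polarType M, M.simple k = w * M.simple l * w⁻¹} := by
  refine R.opposite_type hw (P := (· ∈ polarType M)) (Q := (· ∈ polarType M)) fun l k h => ?_
  rw [R.mem_polarType, R.mem_polarType, ← form_rep R.simplyLaced w, h, R.rep_longest_h hw]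
  simp

omit R in
theorem mem_lineType [Nontrivial B] {i k : B} :
    k ∈ lineType M i ↔
      k ≠ i ∧ (k ∈ polarType M ∨ form M (simpleRoot i) (simpleRoot k) ≠ 0) := by
  simp only [lineType, Set.mem_union, Set.mem_sdiff, Set.mem_singleton_iff, Set.mem_ofPred_eq]
  by_cases hki : k = i
  · simp [hki]
  · have : M i k ≠ 2 ↔ form M (simpleRoot i) (simpleRoot k) ≠ 0 := by
      by_cases h : M i k = 2
      · simp [h, form_simpleRoot_of_eq_two (Ne.symm hki) h]
      · simp [h, form_simpleRoot_of_ne_two (Ne.symm hki) h]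
    simp [hki, this]

theorem opposite_lineType [Nontrivial B] {w : M.Group} (hw : IsLongest M w) {i j : B}
    (hij : rep R.simplyLaced w (simpleRoot i) = -simpleRoot j) :
    lineType M j = {k | ∃ l ∈ lineType M i, M.simple k = w * M.simple l * w⁻¹} := by
  refine R.opposite_type hw (P := (· ∈ lineType M i)) (Q := (· ∈ lineType M j)) fun l k h => ?_
  have h1 : l = i ↔ k = j := by
    constructor
    · rintro rfl
      exact R.simple_injective (by rw [← R.conj_simple_of_rep h, R.conj_simple_of_rep hij])
    · rintro rfl
      apply R.simple_injective
      have := (R.conj_simple_of_rep h).trans (R.conj_simple_of_rep hij).symm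
      simpa using this
  have h2 : form M (simpleRoot i) (simpleRoot l) = form M (simpleRoot j) (simpleRoot k) := by
    rw [← form_rep R.simplyLaced w, h, hij]; simp
  have h3 : l ∈ polarType M ↔ k ∈ polarType M := by
    rw [R.mem_polarType, R.mem_polarType, ← form_rep R.simplyLaced w, h, R.rep_longest_h hw]
    simp
  rw [mem_lineType, mem_lineType, h2, h3, Ne, Ne, h1]

end HighestRootDatum

end HighestRoot

theorem exists_isLongest {B : Type*} (M : CoxeterMatrix B) [Finite M.Group] :
    ∃ w, IsLongest M w :=
  Finite.exists_max fun w : M.Group => M.toCoxeterSystem.length w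

namespace Building

/-! ### Weyl distance and residues -/

section Distance

variable {B Δ : Type*} {M : CoxeterMatrix B} (𝔅 : Building M Δ)

theorem δ_self (C : Δ) : 𝔅.δ C C = 1 := (𝔅.δ_eq_one_iff C C).2 rfl

theorem simple_ne_one (i : B) : M.simple i ≠ 1 := by
  intro h
  have : len (M.simple i) = 1 := M.toCoxeterSystem.length_simple i
  rw [h, (len_eq_zero_iff _).2 rfl] at this
  exact zero_ne_one this

theorem adjacent_symm {C D : Δ} {i : B} (h : 𝔅.δ C D = M.simple i) : 𝔅.δ D C = M.simple i := by
  have hself : M.simple i * M.simple i = 1 := M.toCoxeterSystem.simple_mul_simple_self i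
  rcases 𝔅.δ_of_adjacent D C C i h with h1 | h1
  · rw [𝔅.δ_self, eq_comm, mul_eq_one_iff_inv_eq, simple_inv] at h1
    exact h1.symm
  · rw [𝔅.δ_self, eq_comm, 𝔅.δ_eq_one_iff] at h1
    rw [h1, 𝔅.δ_self] at h
    exact absurd h.symm (simple_ne_one i)

/-- The axioms only move the first chamber. This version for the second one follows by induction,
moving C one step towards D, and it yields the symmetry `δ_inv`. -/
theorem δ_mul_simple {C D D' : Δ} {i : B} (h : 𝔅.δ D D' = M.simple i)
    (hlt : len (𝔅.δ C D) < len (𝔅.δ C D * M.simple i)) :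
    𝔅.δ C D' = 𝔅.δ C D * M.simple i := by
  induction hn : len (𝔅.δ C D) using Nat.strong_induction_on generalizing C with
  | _ n ih =>
  subst hn
  by_cases h1 : 𝔅.δ C D = 1
  · rw [(𝔅.δ_eq_one_iff C D).1 h1, h, 𝔅.δ_self, one_mul]
  obtain ⟨k, hk⟩ := exists_len_simple_mul_lt h1
  obtain ⟨C', hC', hC'D⟩ := 𝔅.exists_adjacent C D k
  have e1 := len_simple_mul (𝔅.δ C D) k
  have e2 := len_mul_simple (𝔅.δ C D) i
  have e3 := len_simple_mul (𝔅.δ C D * M.simple i) k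
  have e4 := len_mul_simple (M.simple k * 𝔅.δ C D) i
  rw [mul_assoc] at e4
  have := ih (len (𝔅.δ C' D)) (by rw [hC'D]; exact hk) (C := C')
    (by rw [hC'D, mul_assoc]; omega) rfl
  rw [hC'D, mul_assoc] at this
  have h2 := 𝔅.δ_of_length_lt C' D' C k (𝔅.adjacent_symm hC')
    (by rw [this, simple_mul_simple_cancel]; change len _ = len _ + 1; omega)
  rw [h2, this, simple_mul_simple_cancel]

theorem δ_inv (C D : Δ) : 𝔅.δ D C = (𝔅.δ C D)⁻¹ := by
  induction hn : len (𝔅.δ C D) using Nat.strong_induction_on generalizing C with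
  | _ n ih =>
  subst hn
  by_cases h1 : 𝔅.δ C D = 1
  · rw [(𝔅.δ_eq_one_iff C D).1 h1, 𝔅.δ_self, inv_one]
  obtain ⟨k, hk⟩ := exists_len_simple_mul_lt h1
  obtain ⟨C', hC', hC'D⟩ := 𝔅.exists_adjacent C D k
  have := ih _ (by rw [hC'D]; exact hk) C' rfl
  rw [hC'D, mul_inv_rev, simple_inv] at this
  have h2 : (𝔅.δ C D)⁻¹ * M.simple k * M.simple k = (𝔅.δ C D)⁻¹ :=
    mul_simple_mul_simple_cancel _ _
  rw [𝔅.δ_mul_simple hC' (by rw [this, h2, ← len_simple_mul_eq, len_inv]; exact hk), this, h2]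

/-- Each K-adjacent step of the first chamber multiplies the distance on the left by 1 or by a
generator from K. This makes residues equivalence classes and root data of points independent of
chosen chambers. -/
theorem δ_mul_inv_mem_closure {K : Set B} {C D : Δ}
    (h : 𝔅.δ C D ∈ Subgroup.closure (M.simple '' K)) (E : Δ) :
    𝔅.δ C E * (𝔅.δ D E)⁻¹ ∈ Subgroup.closure (M.simple '' K) := by
  have step : ∀ k ∈ K, ∀ u, (∀ C, 𝔅.δ C D = u →
      𝔅.δ C E * (𝔅.δ D E)⁻¹ ∈ Subgroup.closure (M.simple '' K)) →
      ∀ C, 𝔅.δ C D = M.simple k * u →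
      𝔅.δ C E * (𝔅.δ D E)⁻¹ ∈ Subgroup.closure (M.simple '' K) := by
    intro k hk u ih C hC
    obtain ⟨C', hC', hC'D⟩ := 𝔅.exists_adjacent C D k
    rw [hC, simple_mul_simple_cancel] at hC'D
    have := ih C' hC'D
    rcases 𝔅.δ_of_adjacent C' E C k (𝔅.adjacent_symm hC') with h1 | h1
    · rw [h1, mul_assoc]
      exact mul_mem (Subgroup.subset_closure (Set.mem_image_of_mem _ hk)) this
    · rwa [h1]
  generalize hw : 𝔅.δ C D = w at h
  induction h using Subgroup.closure_induction_left generalizing C with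
  | one =>
    rw [(𝔅.δ_eq_one_iff C D).1 hw, mul_inv_cancel]
    exact one_mem _
  | mul_left x hx y _ ih =>
    obtain ⟨k, hk, rfl⟩ := hx
    exact step k hk y (fun _ => ih) C hw
  | inv_mul_cancel x hx y _ ih =>
    obtain ⟨k, hk, rfl⟩ := hx
    rw [simple_inv] at hw
    exact step k hk y (fun _ => ih) C hw

theorem mem_residue_self (K : Set B) (C : Δ) : C ∈ 𝔅.residue K C := by
  simp only [residue, Set.mem_ofPred_eq, 𝔅.δ_self]
  exact one_mem _

variable {𝔅} in
theorem mem_residue {K : Set B} {C D : Δ} :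
    D ∈ 𝔅.residue K C ↔ 𝔅.δ C D ∈ Subgroup.closure (M.simple '' K) := Iff.rfl

variable {𝔅}

theorem mem_residue_symm {K : Set B} {C D : Δ} (h : D ∈ 𝔅.residue K C) : C ∈ 𝔅.residue K D := by
  rw [mem_residue, 𝔅.δ_inv]
  exact inv_mem h

theorem mem_residue_trans {K : Set B} {C D E : Δ} (h : D ∈ 𝔅.residue K C)
    (h' : E ∈ 𝔅.residue K D) : E ∈ 𝔅.residue K C := by
  have := mul_mem (𝔅.δ_mul_inv_mem_closure h E) h'
  rwa [inv_mul_cancel_right] at this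

theorem residue_eq {K : Set B} {C D : Δ} (h : D ∈ 𝔅.residue K C) :
    𝔅.residue K D = 𝔅.residue K C :=
  Set.ext fun _ => ⟨mem_residue_trans h, mem_residue_trans (mem_residue_symm h)⟩

theorem residue_mono {K K' : Set B} (h : K ⊆ K') (C : Δ) : 𝔅.residue K C ⊆ 𝔅.residue K' C :=
  fun _ hD => Subgroup.closure_mono (Set.image_mono h) hD

theorem adjacent_mem_residue {K : Set B} {C D : Δ} {i : B} (hi : i ∈ K)
    (h : 𝔅.δ C D = M.simple i) : D ∈ 𝔅.residue K C := by
  rw [mem_residue, h]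
  exact Subgroup.subset_closure (Set.mem_image_of_mem _ hi)

theorem exists_mem_residue {K : Set B} {u : M.Group}
    (hu : u ∈ Subgroup.closure (M.simple '' K)) (C D : Δ) :
    ∃ C' ∈ 𝔅.residue K C, 𝔅.δ C' D = u * 𝔅.δ C D := by
  have step : ∀ k ∈ K, ∀ y : M.Group, (∃ C' ∈ 𝔅.residue K C, 𝔅.δ C' D = y * 𝔅.δ C D) →
      ∃ C' ∈ 𝔅.residue K C, 𝔅.δ C' D = M.simple k * y * 𝔅.δ C D := by
    rintro k hk y ⟨C', hC', h⟩
    obtain ⟨C'', h1, h2⟩ := 𝔅.exists_adjacent C' D k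
    exact ⟨C'', mem_residue_trans hC' (adjacent_mem_residue hk (𝔅.adjacent_symm h1)),
      by rw [h2, h, mul_assoc]⟩
  induction hu using Subgroup.closure_induction_left with
  | one => exact ⟨C, 𝔅.mem_residue_self K C, (one_mul _).symm⟩
  | mul_left x hx y _ ih =>
    obtain ⟨k, hk, rfl⟩ := hx
    exact step k hk y ih
  | inv_mul_cancel x hx y _ ih =>
    obtain ⟨k, hk, rfl⟩ := hx
    rw [simple_inv]
    exact step k hk y ih

/-- Two chambers `C` and `D` lie with a chamber at any given distance from `C` in a common
apartment. -/
theorem exists_δ_eq (C D : Δ) (u : M.Group) : ∃ E, 𝔅.δ C E = u ∧ 𝔅.δ E D = u⁻¹ * 𝔅.δ C D := by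
  induction hn : len u using Nat.strong_induction_on generalizing u with
  | _ n ih =>
  subst hn
  by_cases h1 : u = 1
  · subst h1
    exact ⟨C, 𝔅.δ_self C, by simp⟩
  obtain ⟨i, hi⟩ := exists_len_mul_simple_lt h1
  obtain ⟨E, hE, hE'⟩ := ih _ hi _ rfl
  obtain ⟨E', h2, h3⟩ := 𝔅.exists_adjacent E D i
  refine ⟨E', ?_, ?_⟩
  · rw [𝔅.δ_mul_simple (𝔅.adjacent_symm h2) (by rwa [hE, mul_simple_mul_simple_cancel]), hE,
      mul_simple_mul_simple_cancel]
  · rw [h3, hE', mul_inv_rev, simple_inv, mul_assoc, simple_mul_simple_cancel]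

theorem mem_closure_simple_singleton {i : B} {w : M.Group}
    (h : w ∈ Subgroup.closure (M.simple '' {i})) : w = 1 ∨ w = M.simple i := by
  have hself : M.simple i * M.simple i = 1 := M.toCoxeterSystem.simple_mul_simple_self i
  rw [Set.image_singleton] at h
  induction h using Subgroup.closure_induction with
  | mem _ hx => exact Or.inr hx
  | one => exact Or.inl rfl
  | mul _ _ _ _ h1 h2 => rcases h1 with rfl | rfl <;> rcases h2 with rfl | rfl <;> simp [hself]
  | inv _ _ h => rcases h with rfl | rfl <;> simp [simple_inv]

theorem mem_residue_singleton {i : B} {C D : Δ} :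
    D ∈ 𝔅.residue {i} C ↔ D = C ∨ 𝔅.δ C D = M.simple i := by
  constructor
  · intro h
    refine (mem_closure_simple_singleton h).imp_left fun h => ?_
    exact ((𝔅.δ_eq_one_iff C D).1 h).symm
  · rintro (rfl | h)
    · exact 𝔅.mem_residue_self _ _
    · exact adjacent_mem_residue rfl h

theorem δ_eq_simple_of_adjacent {i : B} {C D E : Δ} (h : 𝔅.δ C D = M.simple i)
    (h' : 𝔅.δ C E = M.simple i) (hne : D ≠ E) : 𝔅.δ D E = M.simple i :=
  (mem_residue_singleton.1 (mem_residue_trans (mem_residue_symm (adjacent_mem_residue rfl h))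
    (adjacent_mem_residue rfl h'))).resolve_left hne.symm

end Distance

/-! ### Simplices as residues -/

section Simplex

variable {B Δ : Type*} {M : CoxeterMatrix B} {𝔅 : Building M Δ} {J : Set B}

variable (𝔅 J) in
/-- The simplex of type `J` contained in a chamber. -/
def face (C : Δ) : 𝔅.Simplex J := ⟨𝔅.residue Jᶜ C, C, rfl⟩

theorem mem_face (C : Δ) : C ∈ (face 𝔅 J C).1 := 𝔅.mem_residue_self _ _

theorem Simplex.eq_residue {F : 𝔅.Simplex J} {C : Δ} (h : C ∈ F.1) : F.1 = 𝔅.residue Jᶜ C := by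
  obtain ⟨_, D, rfl⟩ := F
  exact (residue_eq h).symm

theorem Simplex.eq_face {F : 𝔅.Simplex J} {C : Δ} (h : C ∈ F.1) : F = face 𝔅 J C :=
  Subtype.ext (Simplex.eq_residue h)

theorem Simplex.eq_of_mem {F G : 𝔅.Simplex J} {C : Δ} (hF : C ∈ F.1) (hG : C ∈ G.1) : F = G :=
  (Simplex.eq_face hF).trans (Simplex.eq_face hG).symm

theorem Simplex.exists_mem (F : 𝔅.Simplex J) : ∃ C, C ∈ F.1 := by
  obtain ⟨_, C, rfl⟩ := F
  exact ⟨C, 𝔅.mem_residue_self _ _⟩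

theorem Simplex.δ_mem {F : 𝔅.Simplex J} {C D : Δ} (hC : C ∈ F.1) (hD : D ∈ F.1) :
    𝔅.δ C D ∈ Subgroup.closure (M.simple '' Jᶜ) := by
  rwa [Simplex.eq_residue hC] at hD

theorem Simplex.mem_of_δ_mem {F : 𝔅.Simplex J} {C D : Δ} (hC : C ∈ F.1)
    (hD : 𝔅.δ C D ∈ Subgroup.closure (M.simple '' Jᶜ)) : D ∈ F.1 := by
  rwa [Simplex.eq_residue hC]

theorem Simplex.mem_of_adjacent {F : 𝔅.Simplex J} {C D : Δ} {k : B} (hC : C ∈ F.1)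
    (hk : k ∉ J) (h : 𝔅.δ C D = M.simple k) : D ∈ F.1 := by
  rw [Simplex.eq_residue hC]
  exact adjacent_mem_residue hk h

end Simplex

/-! ### Lines as panels of polar cotype -/

section Lines

variable {B Δ : Type*} [Fintype B] [DecidableEq B] {M : CoxeterMatrix B} {𝔅 : Building M Δ}

variable (𝔅) in
/-- The line of the long root subgroup geometry determined by the panel of cotype `i` of a
chamber `C`. -/
def panelLine (i : B) (C : Δ) : Set 𝔅.Point :=
  {x | ∃ D ∈ x.1, D ∈ 𝔅.residue {i} C}

theorem shadow_face (i : B) (C : Δ) :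
    shadow (polarType M) (face 𝔅 {i}ᶜ C) = panelLine 𝔅 i C := by
  ext x
  simp only [shadow, Incident, face, compl_compl, panelLine]
  rfl

theorem panelLine_mem_lines {i : B} (hi : i ∈ polarType M) (C : Δ) :
    panelLine 𝔅 i C ∈ 𝔅.lines := ⟨i, hi, face 𝔅 {i}ᶜ C, (shadow_face i C).symm⟩

theorem panelLine_eq {i : B} {C D : Δ} (h : D ∈ 𝔅.residue {i} C) :
    panelLine 𝔅 i D = panelLine 𝔅 i C := by
  simp only [panelLine, residue_eq h]

theorem exists_eq_panelLine {L : Set 𝔅.Point} (hL : L ∈ 𝔅.lines) :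
    ∃ i ∈ polarType M, ∃ C, L = panelLine 𝔅 i C := by
  obtain ⟨i, hi, P, rfl⟩ := hL
  obtain ⟨C, hC⟩ := P.exists_mem
  exact ⟨i, hi, C, by rw [Simplex.eq_face hC, shadow_face]⟩

theorem exists_eq_panelLine_of_mem {L : Set 𝔅.Point} (hL : L ∈ 𝔅.lines) {x : 𝔅.Point}
    (hx : x ∈ L) : ∃ i ∈ polarType M, ∃ C ∈ x.1, L = panelLine 𝔅 i C := by
  obtain ⟨i, hi, C, rfl⟩ := exists_eq_panelLine hL
  obtain ⟨D, hD, hDC⟩ := hx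
  exact ⟨i, hi, D, hD, (panelLine_eq hDC).symm⟩

theorem mem_panelLine {i : B} {C : Δ} {x : 𝔅.Point} (hC : C ∈ x.1) : x ∈ panelLine 𝔅 i C :=
  ⟨C, hC, 𝔅.mem_residue_self _ _⟩

theorem mem_panelLine_of_adjacent {i : B} {C D : Δ} {y : 𝔅.Point} (h : 𝔅.δ C D = M.simple i)
    (hD : D ∈ y.1) : y ∈ panelLine 𝔅 i C :=
  ⟨D, hD, adjacent_mem_residue rfl h⟩

theorem exists_adjacent_of_mem_panelLine {i : B} {C : Δ} {x y : 𝔅.Point} (hC : C ∈ x.1)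
    (hy : y ∈ panelLine 𝔅 i C) (hxy : y ≠ x) : ∃ D ∈ y.1, 𝔅.δ C D = M.simple i := by
  obtain ⟨D, hD, h⟩ := hy
  rcases mem_residue_singleton.1 h with rfl | h
  · exact absurd (Simplex.eq_of_mem hD hC) hxy
  · exact ⟨D, hD, h⟩

end Lines

end Building

/-! ### Roots of points and mutual positions -/

namespace HighestRootDatum

open Building

variable {B Δ : Type*} [Fintype B] [DecidableEq B] [Nontrivial B] {M : CoxeterMatrix B}
  (R : HighestRootDatum M) {𝔅 : Building M Δ}

/-- The image of the highest root under the Weyl distance from a chamber to a point. -/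
noncomputable def pointRoot (C : Δ) (y : 𝔅.Point) : B → ℤ :=
  rep R.simplyLaced (𝔅.δ C y.exists_mem.choose) R.h

/-- Distances from C to two chambers of y differ by a right factor in the parabolic subgroup of the
nonpolar nodes, which fixes h. -/
theorem pointRoot_eq {C D : Δ} {y : 𝔅.Point} (hD : D ∈ y.1) :
    R.pointRoot C y = rep R.simplyLaced (𝔅.δ C D) R.h := by
  have h := R.rep_h_of_mem_closure (𝔅.δ_mul_inv_mem_closure
    (Simplex.δ_mem hD y.exists_mem.choose_spec) C)
  rw [𝔅.δ_inv C D, 𝔅.δ_inv C _, inv_inv, rep_mul] at h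
  rw [pointRoot, ← h, rep_rep_inv, h]

omit [Nontrivial B] in
theorem isRoot_pointRoot (C : Δ) (y : 𝔅.Point) : IsRoot M (R.pointRoot C y) :=
  R.isRoot.rep _ _

theorem pointRoot_of_mem {C : Δ} {y : 𝔅.Point} (hC : C ∈ y.1) : R.pointRoot C y = R.h := by
  rw [R.pointRoot_eq hC, 𝔅.δ_self, rep_one]

theorem mem_of_pointRoot_eq {C : Δ} {y : 𝔅.Point} (h : R.pointRoot C y = R.h) : C ∈ y.1 := by
  obtain ⟨D, hD⟩ := y.exists_mem
  rw [R.pointRoot_eq hD] at h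
  refine Simplex.mem_of_δ_mem hD ?_
  rw [𝔅.δ_inv]
  exact inv_mem (R.mem_closure_of_rep_h h)

/-- The mutual position of two points: the inner product of the corresponding long roots in an
apartment. It is `2`, `1`, `0`, `-1`, `-2` for equal, collinear, symplectic, special and opposite
points, respectively. -/
noncomputable def pos (x y : 𝔅.Point) : ℤ :=
  form M R.h (R.pointRoot x.exists_mem.choose y)

theorem pos_eq {C : Δ} {x : 𝔅.Point} (hC : C ∈ x.1) (y : 𝔅.Point) :
    R.pos x y = form M R.h (R.pointRoot C y) := by
  obtain ⟨D, hD⟩ := y.exists_mem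
  have h := R.rep_h_of_mem_closure (𝔅.δ_mul_inv_mem_closure
    (Simplex.δ_mem hC x.exists_mem.choose_spec) D)
  rw [pos, R.pointRoot_eq hD, R.pointRoot_eq hD]
  conv_lhs => rw [← form_rep R.simplyLaced (𝔅.δ C D * (𝔅.δ x.exists_mem.choose D)⁻¹), h,
    ← rep_mul, inv_mul_cancel_right]

theorem pos_comm (x y : 𝔅.Point) : R.pos x y = R.pos y x := by
  obtain ⟨C, hC⟩ := x.exists_mem
  obtain ⟨D, hD⟩ := y.exists_mem
  rw [R.pos_eq hC, R.pos_eq hD, R.pointRoot_eq hD, R.pointRoot_eq hC, form_comm, form_rep_left,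
    𝔅.δ_inv D C, inv_inv]

omit [Nontrivial B] in
theorem pos_le_two (x y : 𝔅.Point) : R.pos x y ≤ 2 := R.form_h_le_two (R.isRoot_pointRoot _ _)

omit [Nontrivial B] in
theorem neg_two_le_pos (x y : 𝔅.Point) : -2 ≤ R.pos x y :=
  R.neg_two_le_form R.isRoot (R.isRoot_pointRoot _ _)

theorem pos_self (x : 𝔅.Point) : R.pos x x = 2 := by
  obtain ⟨C, hC⟩ := x.exists_mem
  rw [R.pos_eq hC, R.pointRoot_of_mem hC, R.form_h_self]

theorem pos_eq_two_iff {x y : 𝔅.Point} : R.pos x y = 2 ↔ x = y := by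
  constructor
  · intro h
    obtain ⟨C, hC⟩ := x.exists_mem
    rw [R.pos_eq hC] at h
    exact Simplex.eq_of_mem hC
      (R.mem_of_pointRoot_eq (R.eq_h_of_form_eq_two (R.isRoot_pointRoot _ _) h))
  · rintro rfl
    exact R.pos_self x

section Panel

variable {C D E : Δ} {i : B}

theorem pointRoot_adjacent (h : 𝔅.δ C D = M.simple i) (y : 𝔅.Point) :
    R.pointRoot D y = R.pointRoot C y - form M (R.pointRoot C y) (simpleRoot i) • simpleRoot i ∨
      R.pointRoot D y = R.pointRoot C y := by
  obtain ⟨E, hE⟩ := y.exists_mem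
  rw [R.pointRoot_eq hE, R.pointRoot_eq hE]
  rcases 𝔅.δ_of_adjacent C E D i (𝔅.adjacent_symm h) with h1 | h1
  · left; rw [h1, rep_mul, rep_simple]
  · right; rw [h1]

/-- A positive pairing forces s_i to lengthen the distance from C to y, so every other chamber of
the panel sees the reflected root. For pairing 0 the reflection changes nothing. -/
theorem pointRoot_adjacent_of_nonneg (h : 𝔅.δ C D = M.simple i) {y : 𝔅.Point}
    (hnn : 0 ≤ form M (R.pointRoot C y) (simpleRoot i)) :
    R.pointRoot D y =
      R.pointRoot C y - form M (R.pointRoot C y) (simpleRoot i) • simpleRoot i := by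
  rcases hnn.eq_or_lt with h0 | h0
  · refine (R.pointRoot_adjacent h y).elim id fun h1 => ?_
    rw [h1, ← h0, zero_smul, sub_zero]
  obtain ⟨E, hE⟩ := y.exists_mem
  rw [R.pointRoot_eq hE] at h0 ⊢
  rw [R.pointRoot_eq hE]
  have hlt : len (𝔅.δ C E)⁻¹ < len ((𝔅.δ C E)⁻¹ * M.simple i) := by
    refine len_lt_len_mul_simple R.simplyLaced fun h1 => ?_
    have := R.form_h_nonneg (neg_nonneg.2 h1)
    rw [map_neg, ← form_rep_left] at this
    omega
  rw [← len_simple_mul_eq, len_inv] at hlt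
  have := len_simple_mul (𝔅.δ C E) i
  rw [𝔅.δ_of_length_lt C E D i (𝔅.adjacent_symm h) (by change len _ = len _ + 1; omega), rep_mul,
    rep_simple]

theorem exists_pointRoot_adjacent (C : Δ) (i : B) (y : 𝔅.Point) :
    ∃ D, 𝔅.δ C D = M.simple i ∧ R.pointRoot D y =
      R.pointRoot C y - form M (R.pointRoot C y) (simpleRoot i) • simpleRoot i := by
  obtain ⟨E, hE⟩ := y.exists_mem
  obtain ⟨D, hD, hDE⟩ := 𝔅.exists_adjacent C E i
  refine ⟨D, 𝔅.adjacent_symm hD, ?_⟩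
  rw [R.pointRoot_eq hE, R.pointRoot_eq hE, hDE, rep_mul, rep_simple]

omit [Nontrivial B] in
theorem form_reflect_simpleRoot (v : B → ℤ) (i : B) :
    form M (v - form M v (simpleRoot i) • simpleRoot i) (simpleRoot i) =
      -form M v (simpleRoot i) := by
  rw [map_sub, map_smul, LinearMap.sub_apply, LinearMap.smul_apply, form_simpleRoot_self,
    smul_eq_mul]
  ring

/-- At most one chamber of the panel sees the reflected root: if D does, the pairing is positive
there, and passing from D to E reflects back. -/
theorem pointRoot_eq_or_of_ne (hD : 𝔅.δ C D = M.simple i) (hE : 𝔅.δ C E = M.simple i)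
    (hDE : D ≠ E) {y : 𝔅.Point} (hneg : form M (R.pointRoot C y) (simpleRoot i) < 0) :
    R.pointRoot D y = R.pointRoot C y ∨ R.pointRoot E y = R.pointRoot C y := by
  refine (R.pointRoot_adjacent hD y).elim (fun h1 => Or.inr ?_) Or.inl
  have h2 : form M (R.pointRoot D y) (simpleRoot i) = -form M (R.pointRoot C y) (simpleRoot i) := by
    rw [h1, form_reflect_simpleRoot]
  rw [R.pointRoot_adjacent_of_nonneg (δ_eq_simple_of_adjacent hD hE hDE) (by omega), h2, h1]
  module

/-- In a thick panel, a chamber nearest to one point can be moved away from that point without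
coming nearer to a given second point. -/
theorem exists_adjacent_generic (hthick : 𝔅.IsThick) (C : Δ) (i : B) (y₁ y₂ : 𝔅.Point)
    (h₁ : 0 < form M (R.pointRoot C y₁) (simpleRoot i)) :
    ∃ D, 𝔅.δ C D = M.simple i ∧ R.pointRoot D y₁ =
      R.pointRoot C y₁ - form M (R.pointRoot C y₁) (simpleRoot i) • simpleRoot i ∧
      ∃ m : ℤ, 0 ≤ m ∧ R.pointRoot D y₂ = R.pointRoot C y₂ - m • simpleRoot i := by
  obtain ⟨D, E, hne, hD, hE⟩ := hthick C i
  by_cases h₂ : 0 ≤ form M (R.pointRoot C y₂) (simpleRoot i)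
  · exact ⟨D, hD, R.pointRoot_adjacent_of_nonneg hD h₁.le, _, h₂,
      R.pointRoot_adjacent_of_nonneg hD h₂⟩
  · rcases R.pointRoot_eq_or_of_ne hD hE hne (not_le.1 h₂) with h | h
    · exact ⟨D, hD, R.pointRoot_adjacent_of_nonneg hD h₁.le, 0, le_rfl, by simp [h]⟩
    · exact ⟨E, hE, R.pointRoot_adjacent_of_nonneg hE h₁.le, 0, le_rfl, by simp [h]⟩

include R in
theorem notMem_of_adjacent (hi : i ∈ polarType M) (h : 𝔅.δ C D = M.simple i) {x : 𝔅.Point}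
    (hC : C ∈ x.1) : D ∉ x.1 := by
  intro hD
  have h1 := R.pointRoot_eq (C := C) hD
  rw [h, R.pointRoot_of_mem hC, rep_simple, R.mem_polarType.1 hi, one_smul, eq_comm,
    sub_eq_self] at h1
  simpa using congrFun h1 i

end Panel

/-! ### Lines seen from a chamber -/

section Line

variable {L : Set 𝔅.Point} (hL : L ∈ 𝔅.lines)

include hL

/-- Seen from a chamber, all points of a line but one have the same root. -/
theorem exists_pointRoot_line (D : Δ) : ∃ e ∈ L, ∃ a b : B → ℤ, R.pointRoot D e = a ∧
    (∀ y ∈ L, y ≠ e → R.pointRoot D y = b) ∧ form M a b = 1 ∧ form M R.h b ≤ form M R.h a := by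
  obtain ⟨i, hi, C₀, rfl⟩ := exists_eq_panelLine hL
  -- The chamber C of the panel nearest to D carries the exceptional point; a - b is the positive
  -- root δ(D, C)α_i.
  obtain ⟨C, hC, hlt⟩ : ∃ C ∈ 𝔅.residue {i} C₀,
      len (𝔅.δ D C) < len (𝔅.δ D C * M.simple i) := by
    by_cases h : len (𝔅.δ D C₀) < len (𝔅.δ D C₀ * M.simple i)
    · exact ⟨C₀, 𝔅.mem_residue_self _ _, h⟩
    · obtain ⟨C, h1, h2⟩ := 𝔅.exists_adjacent C₀ D i
      have h3 : 𝔅.δ D C = 𝔅.δ D C₀ * M.simple i := by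
        rw [𝔅.δ_inv C D, h2, mul_inv_rev, simple_inv, ← 𝔅.δ_inv]
      refine ⟨C, adjacent_mem_residue rfl (𝔅.adjacent_symm h1), ?_⟩
      have := len_mul_simple (𝔅.δ D C₀) i
      rw [h3, mul_simple_mul_simple_cancel]
      omega
  rw [← panelLine_eq hC]
  have h1 := R.mem_polarType.1 hi
  refine ⟨face 𝔅 _ C, mem_panelLine (mem_face C), _, rep R.simplyLaced (𝔅.δ D C * M.simple i) R.h,
    R.pointRoot_eq (mem_face C), fun y hy hne => ?_, ?_, ?_⟩
  · obtain ⟨E, hE, hCE⟩ := exists_adjacent_of_mem_panelLine (mem_face C) hy hne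
    rw [R.pointRoot_eq hE, 𝔅.δ_mul_simple hCE hlt]
  · rw [rep_mul, form_rep, rep_simple, h1, one_smul, map_sub, R.form_h_self, h1]; norm_num
  · rw [rep_mul, rep_simple, h1, one_smul, map_sub, map_sub]
    have := R.form_h_nonneg (rep_simpleRoot_nonneg R.simplyLaced hlt)
    linarith

theorem one_le_form_pointRoot {x y : 𝔅.Point} (hx : x ∈ L) (hy : y ∈ L) (D : Δ) :
    1 ≤ form M (R.pointRoot D x) (R.pointRoot D y) := by
  obtain ⟨e, -, a, b, he, hb, hab, -⟩ := R.exists_pointRoot_line hL D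
  by_cases h : R.pointRoot D x = R.pointRoot D y
  · rw [h, (R.isRoot_pointRoot D y).form_self R.simplyLaced]; norm_num
  by_cases hxe : x = e
  · have hye : y ≠ e := by rintro rfl; exact h (by rw [hxe])
    rw [hxe, he, hb y hy hye, hab]
  · have hye : y = e := by
      by_contra hye
      exact h (by rw [hb x hx hxe, hb y hy hye])
    rw [hye, he, hb x hx hxe, form_comm, hab]

/-- On a line, the least position with respect to a given point is exceeded at most once. -/
theorem eq_of_pos_lt (z : 𝔅.Point) {u v t : 𝔅.Point} (hu : u ∈ L) (hv : v ∈ L) (ht : t ∈ L)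
    (huv : R.pos z u < R.pos z v) (hut : R.pos z u < R.pos z t) : v = t := by
  obtain ⟨D, hD⟩ := z.exists_mem
  obtain ⟨e, heL, a, b, he, hb, -, hab⟩ := R.exists_pointRoot_line hL D
  have hposb : ∀ y ∈ L, y ≠ e → R.pos z y = form M R.h b := fun y hy hne => by
    rw [R.pos_eq hD, hb y hy hne]
  have hposa : R.pos z e = form M R.h a := by rw [R.pos_eq hD, he]
  by_cases hue : u = e
  · have hve : v ≠ e := by rintro rfl; rw [hue] at huv; exact huv.false
    rw [hue, hposa, hposb v hv hve] at huv
    exact absurd huv hab.not_gt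
  · rw [hposb u hu hue] at huv hut
    have hve : v = e := by
      by_contra h; rw [hposb v hv h] at huv; exact huv.false
    have hte : t = e := by
      by_contra h; rw [hposb t ht h] at hut; exact hut.false
    rw [hve, hte]

end Line

/-! ### Collinearity and common neighbours in terms of positions -/

section Collinear

theorem Collinear.one_le_form {x y : 𝔅.Point} (h : Collinear 𝔅.lines x y) (D : Δ) :
    1 ≤ form M (R.pointRoot D x) (R.pointRoot D y) := by
  obtain ⟨-, L, hL, hx, hy⟩ := h
  exact R.one_le_form_pointRoot hL hx hy D

theorem pos_of_collinear {x y : 𝔅.Point} (h : Collinear 𝔅.lines x y) : R.pos x y = 1 := by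
  obtain ⟨C, hC⟩ := x.exists_mem
  have h1 := Collinear.one_le_form R h C
  rw [R.pointRoot_of_mem hC, ← R.pos_eq hC] at h1
  have h2 := R.pos_le_two x y
  have h3 : R.pos x y ≠ 2 := fun h2 => h.1 (R.pos_eq_two_iff.1 h2)
  omega

omit [DecidableEq B] [Nontrivial B] in
theorem exists_minimal_sum {x : Set Δ} (hx : x.Nonempty) (f : Δ → B → ℤ)
    (hf : ∀ C ∈ x, 0 ≤ f C) : ∃ C ∈ x, ∀ D ∈ x, ∑ b, f C b ≤ ∑ b, f D b := by
  obtain ⟨C, hC, hmin⟩ := exists_minimalFor_of_wellFoundedLT (· ∈ x)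
    (fun C => (∑ b, f C b).toNat) hx
  refine ⟨C, hC, fun D hD => ?_⟩
  have hC0 : 0 ≤ ∑ b, f C b := Finset.sum_nonneg fun b _ => hf C hC b
  have hD0 : 0 ≤ ∑ b, f D b := Finset.sum_nonneg fun b _ => hf D hD b
  by_contra hlt
  have := hmin hD (by simp only; omega)
  simp only at this
  omega

omit [Nontrivial B] in
theorem sum_sub_smul_simpleRoot (v : B → ℤ) (m : ℤ) (i : B) :
    ∑ b, (v - m • simpleRoot i) b = ∑ b, v b - m := by
  simp [Finset.sum_sub_distrib, Pi.single_apply]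

/-- A point has a chamber from which a given point is dominant for the nodes that are not
polar. -/
theorem exists_dominant (x y : 𝔅.Point) : ∃ C ∈ x.1, ∀ k ∉ polarType M,
    0 ≤ form M (R.pointRoot C y) (simpleRoot k) := by
  obtain ⟨C, hC, hmin⟩ := exists_minimal_sum (x := x.1) x.exists_mem
    (fun C => R.h - R.pointRoot C y) fun C _ => sub_nonneg.2 (R.le_h (R.isRoot_pointRoot C y))
  refine ⟨C, hC, fun k hk => ?_⟩
  -- A negative pairing would let a reflection raise the root of y while staying in x, since k is
  -- not polar; this contradicts the minimality of h minus that root.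
  by_contra hneg
  obtain ⟨D, hD, h⟩ := R.exists_pointRoot_adjacent C k y
  have := hmin D (Simplex.mem_of_adjacent hC hk hD)
  simp only [h, Pi.sub_apply R.h, Finset.sum_sub_distrib, sum_sub_smul_simpleRoot] at this
  omega

/-- From a dominant chamber, h minus the root of y satisfies `exists_eq_simpleRoot`. So y is seen as
h - α_i = s_i h, the root of a point on the i-panel. -/
theorem exists_adjacent_of_pos_eq_one {x y : 𝔅.Point} (h : R.pos x y = 1) :
    ∃ i ∈ polarType M, ∃ C ∈ x.1, ∃ D ∈ y.1, 𝔅.δ C D = M.simple i := by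
  obtain ⟨C, hC, hdom⟩ := R.exists_dominant x y
  rw [R.pos_eq hC] at h
  have hroot := R.isRoot_pointRoot C y
  obtain ⟨i, hi, heq⟩ := R.exists_eq_simpleRoot (R.isRoot_sub R.isRoot hroot h)
    (by rw [map_sub, h, R.form_h_self]; norm_num) fun k hk => by
      rw [map_sub, LinearMap.sub_apply, R.notMem_polarType.1 hk]
      have := hdom k hk
      omega
  obtain ⟨D, hD, hDy⟩ := R.exists_pointRoot_adjacent C i y
  refine ⟨i, hi, C, hC, D, R.mem_of_pointRoot_eq ?_, hD⟩
  have hr : R.pointRoot C y = R.h - simpleRoot i := by rw [← heq]; abel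
  rw [hDy, hr, map_sub, LinearMap.sub_apply, R.mem_polarType.1 hi, form_simpleRoot_self]
  module

theorem collinear_iff {x y : 𝔅.Point} : Collinear 𝔅.lines x y ↔ R.pos x y = 1 := by
  refine ⟨R.pos_of_collinear, fun h => ⟨?_, ?_⟩⟩
  · rintro rfl
    rw [R.pos_self] at h
    omega
  · obtain ⟨i, hi, C, hC, D, hD, hCD⟩ := R.exists_adjacent_of_pos_eq_one h
    exact ⟨_, panelLine_mem_lines hi C, mem_panelLine hC, mem_panelLine_of_adjacent hCD hD⟩

/-- An apartment through C and y contains a point for every root, and positions within it are inner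
products. Common neighbours can thus be found in the root system. -/
theorem exists_point (C : Δ) (y : 𝔅.Point) {v : B → ℤ} (hv : IsRoot M v) :
    ∃ z : 𝔅.Point, R.pointRoot C z = v ∧ R.pos z y = form M v (R.pointRoot C y) := by
  obtain ⟨u, rfl⟩ := R.exists_rep_h_eq hv
  obtain ⟨D, hD⟩ := y.exists_mem
  obtain ⟨E, h1, h2⟩ := exists_δ_eq (𝔅 := 𝔅) C D u
  refine ⟨face 𝔅 _ E, by rw [R.pointRoot_eq (mem_face E), h1], ?_⟩
  rw [R.pos_eq (mem_face E), R.pointRoot_eq hD, R.pointRoot_eq hD, h2, rep_mul, form_rep_left]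

theorem exists_common_neighbour {C : Δ} {x y : 𝔅.Point} (hC : C ∈ x.1) {v : B → ℤ}
    (hv : IsRoot M v) (h1 : form M R.h v = 1) (h2 : form M v (R.pointRoot C y) = 1) :
    ∃ z : 𝔅.Point, R.pointRoot C z = v ∧ Collinear 𝔅.lines x z ∧ Collinear 𝔅.lines y z := by
  obtain ⟨z, hz, hzy⟩ := R.exists_point C y hv
  refine ⟨z, hz, R.collinear_iff.2 ?_, R.collinear_iff.2 ?_⟩
  · rw [R.pos_eq hC, hz, h1]
  · rw [pos_comm, hzy, h2]

/-- Let r be the root of y from a dominant chamber. Some polar i has (r, α_i) = -1: otherwise r is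
dominant and orthogonal to h, which has full support, forcing (r, r) = 0. Then r + α_i and h - α_i
both have product 1 with h and with r. -/
theorem exists_two_of_pos_eq_zero {x y : 𝔅.Point} (h : R.pos x y = 0) :
    ∃ z t : 𝔅.Point, z ≠ t ∧ (Collinear 𝔅.lines x z ∧ Collinear 𝔅.lines y z) ∧
      (Collinear 𝔅.lines x t ∧ Collinear 𝔅.lines y t) := by
  obtain ⟨C, hC, hdom⟩ := R.exists_dominant x y
  rw [R.pos_eq hC] at h
  have hroot := R.isRoot_pointRoot C y
  set r := R.pointRoot C y with hr
  have hrr := hroot.form_self R.simplyLaced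
  obtain ⟨i, hi, hneg⟩ : ∃ i ∈ polarType M, form M r (simpleRoot i) < 0 := by
    by_contra! hcon
    have hnn : ∀ k, 0 ≤ form M r (simpleRoot k) := fun k => by
      by_cases hk : k ∈ polarType M
      exacts [hcon k hk, hdom k hk]
    rw [form_comm, form_expand_right] at h
    have hz := (Finset.sum_eq_zero_iff_of_nonneg fun k _ =>
      mul_nonneg (zero_le_one.trans (R.one_le_h k)) (hnn k)).1 h
    rw [form_expand_right, Finset.sum_eq_zero fun k hk => ?_] at hrr
    · omega
    · have := R.one_le_h k
      rw [(mul_eq_zero.1 (hz k hk)).resolve_left (by omega), mul_zero]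
  have hi1 := R.mem_polarType.1 hi
  have hri : form M r (simpleRoot i) = -1 := by
    have h2 := R.neg_two_le_form hroot (isRoot_simpleRoot i)
    have h3 : form M r (simpleRoot i) ≠ -2 := by
      intro h3
      rw [R.eq_neg_of_form_eq_neg_two hroot (isRoot_simpleRoot i) h3, map_neg, h] at hi1
      omega
    omega
  have hrh : form M r R.h = 0 := by rw [form_comm, h]
  have hih : form M (simpleRoot i) R.h = 1 := by rw [form_comm, hi1]
  obtain ⟨z, hz, hz'⟩ := R.exists_common_neighbour (y := y) hC
    (R.isRoot_add hroot (isRoot_simpleRoot i) hri) (by rw [map_add, h, hi1]; norm_num)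
    (by rw [← hr, form_comm, map_add, hrr, hri]; norm_num)
  obtain ⟨t, ht, ht'⟩ := R.exists_common_neighbour (y := y) hC
    (R.isRoot_sub R.isRoot (isRoot_simpleRoot i) hi1)
    (by rw [map_sub, R.form_h_self, hi1]; norm_num)
    (by rw [← hr, form_comm, map_sub, hrh, hri]; norm_num)
  refine ⟨z, t, ?_, hz', ht'⟩
  rintro rfl
  have := congrArg (fun v => form M v (simpleRoot i)) (hz.symm.trans ht)
  simp only [map_add, map_sub, LinearMap.add_apply, LinearMap.sub_apply, hri, hi1,
    form_simpleRoot_self] at this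
  omega

theorem exists_of_pos_eq_neg_one {x y : 𝔅.Point} (h : R.pos x y = -1) :
    ∃ z, Collinear 𝔅.lines x z ∧ Collinear 𝔅.lines y z := by
  obtain ⟨C, hC⟩ := x.exists_mem
  rw [R.pos_eq hC] at h
  have hroot := R.isRoot_pointRoot C y
  obtain ⟨z, -, hz⟩ := R.exists_common_neighbour (y := y) hC (R.isRoot_add R.isRoot hroot h)
    (by rw [map_add, R.form_h_self, h]; norm_num)
    (by rw [map_add, LinearMap.add_apply, hroot.form_self R.simplyLaced, h]; norm_num)
  exact ⟨z, hz⟩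

theorem pointRoot_of_pos_eq_neg_two {x y : 𝔅.Point} (h : R.pos x y = -2) {C : Δ}
    (hC : C ∈ x.1) : R.pointRoot C y = -R.h := by
  rw [R.pos_eq hC] at h
  exact R.eq_neg_of_form_eq_neg_two R.isRoot (R.isRoot_pointRoot C y) h

/-- An opposite y is seen from x as -h, and a neighbour of y then has a negative product with h. -/
theorem pos_ne_neg_two_of_common_neighbour {x y z : 𝔅.Point} (hxz : 0 ≤ R.pos x z)
    (hyz : Collinear 𝔅.lines y z) : R.pos x y ≠ -2 := by
  intro h
  obtain ⟨C, hC⟩ := x.exists_mem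
  have := Collinear.one_le_form R hyz C
  rw [R.pointRoot_of_pos_eq_neg_two h hC, map_neg, LinearMap.neg_apply, ← R.pos_eq hC] at this
  omega

/-- The root of the unique common neighbour of a special pair. -/
theorem pointRoot_centre {x y z : 𝔅.Point} (h : R.pos x y = -1) (hxz : Collinear 𝔅.lines x z)
    (hyz : Collinear 𝔅.lines y z) {C : Δ} (hC : C ∈ x.1) :
    R.pointRoot C z = R.h + R.pointRoot C y := by
  have h1 := R.pos_of_collinear hxz
  rw [R.pos_eq hC] at h h1
  have hz := R.isRoot_pointRoot C z
  have hy := R.isRoot_pointRoot C y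
  have h2 := Collinear.one_le_form R hyz C
  have h3 := R.form_le_two hy hz
  have h4 : form M (R.pointRoot C y) (R.pointRoot C z) ≠ 2 := by
    intro h4
    rw [R.eq_of_form_eq_two hy hz h4, h1] at h
    omega
  have h5 := R.isRoot_sub hy hz (by omega)
  have h6 := R.eq_neg_of_form_eq_neg_two R.isRoot h5 (by rw [map_sub, h, h1]; norm_num)
  rw [← neg_eq_iff_eq_neg.2 h6]; abel

/-- The root of a centre is forced by `pointRoot_centre`, so z and t both lie on one i-panel of a
chamber C of x, which sees y as -α_i. Of two distinct chambers of that panel, one still sees y as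
-α_i, so its point would be special to y rather than collinear. -/
theorem common_neighbour_unique {x y z t : 𝔅.Point} (h : R.pos x y = -1)
    (hxz : Collinear 𝔅.lines x z) (hyz : Collinear 𝔅.lines y z)
    (hxt : Collinear 𝔅.lines x t) (hyt : Collinear 𝔅.lines y t) : z = t := by
  obtain ⟨i, hi, C, hC, D, hD, hCD⟩ := R.exists_adjacent_of_pos_eq_one (R.pos_of_collinear hxz)
  have hi1 := R.mem_polarType.1 hi
  have hz : R.pointRoot C z = R.h - simpleRoot i := by
    rw [R.pointRoot_eq hD, hCD, rep_simple, hi1, one_smul]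
  have hzt : R.pointRoot C z = R.pointRoot C t :=
    (R.pointRoot_centre h hxz hyz hC).trans (R.pointRoot_centre h hxt hyt hC).symm
  have hy : R.pointRoot C y = -simpleRoot i := by
    have := R.pointRoot_centre h hxz hyz hC
    rw [hz] at this
    rw [← sub_eq_iff_eq_add'.2 this]; abel
  obtain ⟨E, hCE, hE⟩ := R.exists_pointRoot_adjacent C i t
  have hEt : E ∈ t.1 := by
    refine R.mem_of_pointRoot_eq ?_
    rw [hE, ← hzt, hz, map_sub, LinearMap.sub_apply, hi1, form_simpleRoot_self]
    module
  by_cases hDE : D = E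
  · exact Simplex.eq_of_mem hD (hDE ▸ hEt)
  exfalso
  have hyi : form M (R.pointRoot C y) (simpleRoot i) = -2 := by
    rw [hy, map_neg, LinearMap.neg_apply, form_simpleRoot_self]
  rcases R.pointRoot_eq_or_of_ne hCD hCE hDE (by rw [hyi]; norm_num) with h1 | h1
  · have := R.pos_of_collinear hyz
    rw [pos_comm, R.pos_eq hD, h1, hy, map_neg, hi1] at this
    omega
  · have := R.pos_of_collinear hyt
    rw [pos_comm, R.pos_eq hEt, h1, hy, map_neg, hi1] at this
    omega

theorem pos_eq_neg_one_of_hasPosition {x y : 𝔅.Point}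
    (h : HasPosition 𝔅.lines .twoPrime x y) : R.pos x y = -1 := by
  obtain ⟨hne, hnc, z, ⟨hz, hz'⟩, huniq⟩ := h
  rw [R.collinear_iff] at hnc
  have h1 := R.pos_le_two x y
  have h2 := R.neg_two_le_pos x y
  have h3 : R.pos x y ≠ 2 := fun h => hne (R.pos_eq_two_iff.1 h)
  have h4 : R.pos x y ≠ 0 := fun h => by
    obtain ⟨t, u, htu, ht, hu⟩ := R.exists_two_of_pos_eq_zero h
    exact htu ((huniq t ht).trans (huniq u hu).symm)
  have h5 := R.pos_ne_neg_two_of_common_neighbour (by rw [R.pos_of_collinear hz]; norm_num) hz'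
  omega

end Collinear

/-! ### Collineations preserve positions -/

section Collineation

variable {θ : Equiv.Perm 𝔅.Point} (hθ : IsCollineation 𝔅.lines θ)

include hθ

omit [Nontrivial B] in
theorem collinear_map {x y : 𝔅.Point} :
    Collinear 𝔅.lines (θ x) (θ y) ↔ Collinear 𝔅.lines x y := by
  constructor
  · rintro ⟨hne, L, hL, hx, hy⟩
    refine ⟨fun h => hne (by rw [h]), θ ⁻¹' L, ?_, hx, hy⟩
    rw [← hθ, Set.image_preimage_eq _ θ.surjective]
    exact hL
  · rintro ⟨hne, L, hL, hx, hy⟩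
    exact ⟨θ.injective.ne hne, θ '' L, (hθ L).2 hL, Set.mem_image_of_mem _ hx,
      Set.mem_image_of_mem _ hy⟩

/-- For distinct noncollinear points, positions 0, -1 and -2 mean several, exactly one and no common
neighbours, and θ respects collinearity in both directions. -/
theorem pos_map (x y : 𝔅.Point) : R.pos (θ x) (θ y) = R.pos x y := by
  have e2 : R.pos (θ x) (θ y) = 2 ↔ R.pos x y = 2 := by
    rw [R.pos_eq_two_iff, R.pos_eq_two_iff, θ.injective.eq_iff]
  have e1 : R.pos (θ x) (θ y) = 1 ↔ R.pos x y = 1 := by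
    rw [← R.collinear_iff, ← R.collinear_iff, collinear_map hθ]
  have key : R.pos x y = 0 ∨ R.pos x y = -1 → R.pos (θ x) (θ y) ≠ -2 := by
    intro hn
    obtain ⟨z, hz, hz'⟩ : ∃ z, Collinear 𝔅.lines x z ∧ Collinear 𝔅.lines y z := by
      rcases hn with h | h
      · obtain ⟨z, -, -, hz, -⟩ := R.exists_two_of_pos_eq_zero h
        exact ⟨z, hz⟩
      · exact R.exists_of_pos_eq_neg_one h
    refine R.pos_ne_neg_two_of_common_neighbour (z := θ z) ?_ ((collinear_map hθ).2 hz')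
    rw [R.pos_of_collinear ((collinear_map hθ).2 hz)]
    norm_num
  have key' : R.pos (θ x) (θ y) = 0 ∨ R.pos (θ x) (θ y) = -1 → R.pos x y ≠ -2 := by
    intro hn h
    obtain ⟨z, hz, hz'⟩ : ∃ z, Collinear 𝔅.lines (θ x) z ∧ Collinear 𝔅.lines (θ y) z := by
      rcases hn with h | h
      · obtain ⟨z, -, -, hz, -⟩ := R.exists_two_of_pos_eq_zero h
        exact ⟨z, hz⟩
      · exact R.exists_of_pos_eq_neg_one h
    obtain ⟨z, rfl⟩ := θ.surjective z
    rw [collinear_map hθ] at hz hz'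
    exact R.pos_ne_neg_two_of_common_neighbour (by rw [R.pos_of_collinear hz]; norm_num) hz' h
  have key0 : R.pos x y = 0 → R.pos (θ x) (θ y) ≠ -1 := by
    intro h h'
    obtain ⟨z, t, hzt, ⟨h1, h2⟩, h3, h4⟩ := R.exists_two_of_pos_eq_zero h
    rw [← collinear_map hθ] at h1 h2 h3 h4
    exact hzt (θ.injective (R.common_neighbour_unique h' h1 h2 h3 h4))
  have key1 : R.pos x y = -1 → R.pos (θ x) (θ y) ≠ 0 := by
    intro h h'
    obtain ⟨z, t, hzt, ⟨h1, h2⟩, h3, h4⟩ := R.exists_two_of_pos_eq_zero h'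
    obtain ⟨z, rfl⟩ := θ.surjective z
    obtain ⟨t, rfl⟩ := θ.surjective t
    rw [collinear_map hθ] at h1 h2 h3 h4
    exact hzt (congrArg θ (R.common_neighbour_unique h h1 h2 h3 h4))
  have b1 := R.pos_le_two x y
  have b2 := R.neg_two_le_pos x y
  have b3 := R.pos_le_two (θ x) (θ y)
  have b4 := R.neg_two_le_pos (θ x) (θ y)
  omega

end Collineation

end HighestRootDatum

/-! ### Opposite points and opposite lines -/

namespace HighestRootDatum

open Building

variable {B Δ : Type*} [Fintype B] [DecidableEq B] {M : CoxeterMatrix B}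
  (R : HighestRootDatum M) {𝔅 : Building M Δ}

section Opposition

include R in
theorem longest_inv {w : M.Group} (hw : IsLongest M w) : w⁻¹ = w := by
  have : w * w = 1 := by
    refine eq_one_of_rep_nonneg R.simplyLaced fun i => ?_
    have := R.rep_longest_nonpos hw (neg_nonneg.2 (R.rep_longest_simpleRoot_nonpos hw i))
    rwa [map_neg, neg_nonpos, ← rep_mul] at this
  exact inv_eq_of_mul_eq_one_left this

omit [Fintype B] [DecidableEq B] in
theorem exists_mem_residue_of_δ_eq_mul {K : Set B} {C D : Δ} {w v : M.Group}
    (h : 𝔅.δ C D = w * v) (hv : v ∈ Subgroup.closure (M.simple '' K)) :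
    ∃ E ∈ 𝔅.residue K D, 𝔅.δ C E = w := by
  obtain ⟨E, hE, hEC⟩ := exists_mem_residue (𝔅 := 𝔅) hv D C
  refine ⟨E, hE, ?_⟩
  rw [𝔅.δ_inv E C, hEC, 𝔅.δ_inv C D, h]
  group

variable [Nontrivial B]

/-- Both δ(C, D) and the longest w send h to -h, so they differ by a right factor stabilizing h.
Moving D within y absorbs that factor. -/
theorem opposite_of_pos_eq_neg_two [Finite M.Group] {x y : 𝔅.Point} (h : R.pos x y = -2) :
    Opposite x y := by
  obtain ⟨w, hw⟩ := exists_isLongest M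
  obtain ⟨C, hC⟩ := x.exists_mem
  obtain ⟨D, hD⟩ := y.exists_mem
  have h1 := R.pointRoot_of_pos_eq_neg_two h hC
  rw [R.pointRoot_eq hD] at h1
  obtain ⟨E, hE, hCE⟩ := exists_mem_residue_of_δ_eq_mul (𝔅 := 𝔅) (C := C) (D := D) (w := w)
    (v := w⁻¹ * 𝔅.δ C D) (by group) (R.mem_closure_of_rep_h (by
      rw [rep_mul, h1, map_neg, R.rep_longest_h hw.inv, neg_neg]))
  exact ⟨w, hw, R.opposite_polarType hw, C, hC, E, Simplex.mem_of_δ_mem hD hE, hCE⟩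

theorem mem_compl_lineType {i k : B} :
    k ∈ (lineType M i)ᶜ ↔
      k = i ∨ k ∈ {k | k ∉ polarType M ∧ form M (simpleRoot i) (simpleRoot k) = 0} := by
  rw [Set.mem_compl_iff, mem_lineType, Set.mem_ofPred_eq]
  tauto

/-- The nodes outside the line type are i and nonpolar nodes whose reflections commute with s_i, so
a possible factor s_i can be pulled to the left. -/
theorem mem_closure_lineType_compl {i : B} (hi : i ∈ polarType M) {w : M.Group}
    (hw : w ∈ Subgroup.closure (M.simple '' (lineType M i)ᶜ)) :
    w ∈ Subgroup.closure (M.simple '' (polarType M)ᶜ) ∨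
      M.simple i * w ∈ Subgroup.closure (M.simple '' (polarType M)ᶜ) := by
  have step : ∀ k ∈ (lineType M i)ᶜ, ∀ u,
      (u ∈ Subgroup.closure (M.simple '' (polarType M)ᶜ) ∨
        M.simple i * u ∈ Subgroup.closure (M.simple '' (polarType M)ᶜ)) →
      (M.simple k * u ∈ Subgroup.closure (M.simple '' (polarType M)ᶜ) ∨
        M.simple i * (M.simple k * u) ∈ Subgroup.closure (M.simple '' (polarType M)ᶜ)) := by
    intro k hk u hu
    rcases mem_compl_lineType.1 hk with rfl | ⟨hkJ, hik⟩
    · rw [simple_mul_simple_cancel]; exact hu.symm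
    · have hk' : M.simple k ∈ Subgroup.closure (M.simple '' (polarType M)ᶜ) :=
        Subgroup.subset_closure (Set.mem_image_of_mem _ hkJ)
      have hne : i ≠ k := fun h => hkJ (h ▸ hi)
      have hm : M i k = 2 := by
        by_contra hm
        rw [form_simpleRoot_of_ne_two hne hm] at hik
        omega
      refine hu.imp (mul_mem hk') fun h => ?_
      rw [← mul_assoc, simple_comm_of_eq_two hm, mul_assoc]
      exact mul_mem hk' h
  induction hw using Subgroup.closure_induction_left with
  | one => exact Or.inl (one_mem _)
  | mul_left x hx y _ ih =>
    obtain ⟨k, hk, rfl⟩ := hx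
    exact step k hk y ih
  | inv_mul_cancel x hx y _ ih =>
    obtain ⟨k, hk, rfl⟩ := hx
    rw [simple_inv]
    exact step k hk y ih

/-- The line determined by a panel is the shadow of the simplex corresponding to it. -/
theorem shadow_face_lineType {i : B} (hi : i ∈ polarType M) (C : Δ) :
    shadow (polarType M) (face 𝔅 (lineType M i) C) = panelLine 𝔅 i C := by
  ext x
  constructor
  · rintro ⟨E, hE, hCE⟩
    rcases mem_closure_lineType_compl hi hCE with h | h
    · rw [𝔅.δ_inv E C] at h
      exact mem_panelLine (Simplex.mem_of_δ_mem hE (inv_mem_iff.1 h))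
    · obtain ⟨C', hC', hC'E⟩ := 𝔅.exists_adjacent C E i
      rw [← hC'E, 𝔅.δ_inv E C'] at h
      exact mem_panelLine_of_adjacent (𝔅.adjacent_symm hC')
        (Simplex.mem_of_δ_mem hE (inv_mem_iff.1 h))
  · rintro ⟨E, hE, hCE⟩
    refine ⟨E, hE, residue_mono ?_ C hCE⟩
    rintro k rfl
    exact mem_compl_lineType.2 (Or.inl rfl)

omit [Nontrivial B] in
theorem rep_apply_of_mem_closure {w : M.Group}
    (hw : w ∈ Subgroup.closure (M.simple '' (polarType M)ᶜ)) {j : B} (hj : j ∈ polarType M)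
    (v : B → ℤ) : rep R.simplyLaced w v j = v j := by
  induction hw using Subgroup.closure_induction generalizing v with
  | mem _ hx =>
    obtain ⟨k, hk, rfl⟩ := hx
    have hne : j ≠ k := fun h => hk (h ▸ hj)
    simp [rep_simple, Pi.single_eq_of_ne hne]
  | one => simp
  | mul _ _ _ _ h1 h2 => rw [rep_mul, h1, h2]
  | inv x _ h => rw [← h (rep R.simplyLaced x⁻¹ v), rep_rep_inv]

/-- Crossing the i-panel of C gives C' with δ(C', D)h = -h. The element v = w⁻¹δ(C', D) fixes h and
α_j, so it preserves the simplex of the second line; absorbing it moves D to a chamber opposite C'.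
-/
theorem oppositeLines_panelLine [Finite M.Group] {i j : B} (hi : i ∈ polarType M)
    (hj : j ∈ polarType M) {C D : Δ}
    (hCD : rep R.simplyLaced (𝔅.δ C D) R.h = simpleRoot i - R.h)
    (hDC : rep R.simplyLaced (𝔅.δ D C) R.h = simpleRoot j - R.h) :
    OppositeLines (panelLine 𝔅 i C) (panelLine 𝔅 j D) := by
  obtain ⟨w, hw⟩ := exists_isLongest M
  obtain ⟨C', hC', hC'D⟩ := 𝔅.exists_adjacent C D i
  have hi1 := R.mem_polarType.1 hi
  set v := w⁻¹ * 𝔅.δ C' D with hv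
  have hvh : rep R.simplyLaced v R.h = R.h := by
    have : rep R.simplyLaced (M.simple i) (simpleRoot i - R.h) = -R.h := by
      rw [rep_simple, map_sub (form M), LinearMap.sub_apply, hi1, form_simpleRoot_self]; module
    rw [hv, hC'D, rep_mul, rep_mul, hCD, this, map_neg, R.rep_longest_h hw.inv, neg_neg]
  have hvJ := R.mem_closure_of_rep_h hvh
  have hαj : rep R.simplyLaced (𝔅.δ C D) (simpleRoot j) = simpleRoot i := by
    have h1 : simpleRoot j = rep R.simplyLaced (𝔅.δ D C) R.h + R.h := by rw [hDC]; abel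
    rw [h1, map_add, 𝔅.δ_inv C D, rep_rep_inv, hCD]; abel
  obtain ⟨k, hk⟩ := R.exists_rep_longest_simpleRoot hw i
  have hvj : rep R.simplyLaced v (simpleRoot j) = simpleRoot k := by
    rw [hv, hC'D, rep_mul, rep_mul, hαj, rep_simple_self, map_neg, R.longest_inv hw, hk, neg_neg]
  -- Being generated by nonpolar reflections, v keeps the polar coordinates, so vα_j = α_k has
  -- coordinate 1 at j.
  obtain rfl : k = j := by
    have := R.rep_apply_of_mem_closure hvJ hj (simpleRoot j)
    rw [hvj] at this
    by_contra hne
    simp [Pi.single_eq_of_ne (Ne.symm hne)] at this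
  have hvK := R.mem_closure_of_rep_h_of_rep_simpleRoot hj hvh hvj
  obtain ⟨E, hE, hCE⟩ := exists_mem_residue_of_δ_eq_mul (𝔅 := 𝔅) (C := C') (D := D) (w := w)
    (v := v) (by rw [hv]; group) hvK
  refine ⟨i, hi, k, hj, face 𝔅 _ C', face 𝔅 _ D, ?_, shadow_face_lineType hj D, w, hw,
    R.opposite_lineType hw hk, C', mem_face C', E, ?_, hCE⟩
  · rw [shadow_face_lineType hi, panelLine_eq (adjacent_mem_residue rfl (𝔅.adjacent_symm hC'))]
  · exact residue_mono (fun l hl => mem_compl_lineType.2 (Or.inr hl)) D hE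

end Opposition

/-! ### Simultaneous normal form for two points -/

section Reduction

variable [Nontrivial B]

/-- Given two points in the same position, either collinear or special, to a point `x`, some
chamber of `x` sees both of them along a panel of polar cotype. -/
theorem exists_simpleRoot_pair (hthick : 𝔅.IsThick) {x y₁ y₂ : 𝔅.Point} {a : ℤ}
    (ha : a = 0 ∨ a = 1) (h₁ : R.pos x y₁ = 1 - 2 * a) (h₂ : R.pos x y₂ = 1 - 2 * a) :
    ∃ C ∈ x.1, ∃ i₁ ∈ polarType M, ∃ i₂ ∈ polarType M,
      R.pointRoot C y₁ = simpleRoot i₁ - a • R.h ∧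
      R.pointRoot C y₂ = simpleRoot i₂ - a • R.h := by
  -- Adding a times h treats the collinear case a = 0 and the special case a = 1 together: the
  -- result is a root of product 1 with h.
  have hroot : ∀ y : 𝔅.Point, R.pos x y = 1 - 2 * a → ∀ C ∈ x.1,
      IsRoot M (R.pointRoot C y + a • R.h) ∧ form M R.h (R.pointRoot C y + a • R.h) = 1 := by
    intro y hy C hC
    rw [R.pos_eq hC] at hy
    constructor
    · rcases ha with rfl | rfl
      · simpa using R.isRoot_pointRoot C y
      · rw [one_smul]
        exact R.isRoot_add (R.isRoot_pointRoot C y) R.isRoot (by rw [form_comm, hy]; norm_num)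
    · rw [map_add, map_smul, hy, R.form_h_self, smul_eq_mul]; ring
  have hnn : ∀ y : 𝔅.Point, R.pos x y = 1 - 2 * a → ∀ C ∈ x.1,
      0 ≤ R.pointRoot C y + a • R.h := fun y hy C hC =>
    R.nonneg_of_form_h_pos (hroot y hy C hC).1 (by rw [(hroot y hy C hC).2]; norm_num)
  -- Minimizing the sum of both heights makes both roots antidominant at the nonpolar nodes: by
  -- thickness, one root can be lowered without raising the other.
  obtain ⟨C, hC, hmin⟩ := exists_minimal_sum (x := x.1) x.exists_mem
    (fun C => (R.pointRoot C y₁ + a • R.h) + (R.pointRoot C y₂ + a • R.h)) fun C hC =>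
    add_nonneg (hnn y₁ h₁ C hC) (hnn y₂ h₂ C hC)
  have hmin' : ∀ D ∈ x.1, ∑ b, R.pointRoot C y₁ b + ∑ b, R.pointRoot C y₂ b ≤
      ∑ b, R.pointRoot D y₁ b + ∑ b, R.pointRoot D y₂ b := by
    intro D hD
    have := hmin D hD
    simp only [Pi.add_apply, Finset.sum_add_distrib] at this
    linarith
  have key : ∀ z₁ z₂ : 𝔅.Point, (∀ D ∈ x.1, ∑ b, R.pointRoot C z₁ b + ∑ b, R.pointRoot C z₂ b ≤
      ∑ b, R.pointRoot D z₁ b + ∑ b, R.pointRoot D z₂ b) → ∀ k ∉ polarType M,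
      form M (R.pointRoot C z₁ + a • R.h) (simpleRoot k) ≤ 0 := by
    intro z₁ z₂ hz k hk
    rw [map_add, map_smul, LinearMap.add_apply, LinearMap.smul_apply, R.notMem_polarType.1 hk,
      smul_zero, add_zero]
    by_contra hpos
    obtain ⟨D, hD, e₁, m, hm, e₂⟩ := R.exists_adjacent_generic hthick C k z₁ z₂ (not_le.1 hpos)
    have := hz D (Simplex.mem_of_adjacent hC hk hD)
    rw [e₁, e₂, sum_sub_smul_simpleRoot, sum_sub_smul_simpleRoot] at this
    omega
  obtain ⟨i₁, hi₁, e₁⟩ := R.exists_eq_simpleRoot (hroot y₁ h₁ C hC).1 (hroot y₁ h₁ C hC).2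
    (key y₁ y₂ hmin')
  obtain ⟨i₂, hi₂, e₂⟩ := R.exists_eq_simpleRoot (hroot y₂ h₂ C hC).1 (hroot y₂ h₂ C hC).2
    (key y₂ y₁ fun D hD => by have := hmin' D hD; omega)
  exact ⟨C, hC, i₁, hi₁, i₂, hi₂, eq_sub_of_add_eq e₁, eq_sub_of_add_eq e₂⟩

end Reduction

/-! ### Excluding special and collinear images -/

section Domestic

variable [Nontrivial B] {θ : Equiv.Perm 𝔅.Point} (hthick : 𝔅.IsThick)
  (hθ : IsCollineation 𝔅.lines θ)

include R hthick hθ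

omit hthick in
theorem pos_symm_apply (x y : 𝔅.Point) : R.pos (θ.symm x) y = R.pos x (θ y) := by
  rw [← R.pos_map hθ, θ.apply_symm_apply]

/-- A point-domestic and line-domestic collineation maps no point to a special one. -/
theorem pos_ne_neg_one [Finite M.Group] (hpoint : IsPointDomestic θ) (hline : IsLineDomestic θ)
    (x : 𝔅.Point) : R.pos x (θ x) ≠ -1 := by
  intro h
  have h' : R.pos x (θ.symm x) = -1 := by rw [R.pos_comm, R.pos_symm_apply hθ, h]
  obtain ⟨C, hC, i, hi, j, hj, e₁, e₂⟩ := R.exists_simpleRoot_pair hthick (a := 1) (Or.inr rfl)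
    (h.trans (by norm_num)) (h'.trans (by norm_num))
  rw [one_smul] at e₁ e₂
  have hi1 := R.mem_polarType.1 hi
  have hj1 := R.mem_polarType.1 hj
  have hL := panelLine_mem_lines (𝔅 := 𝔅) hi C
  have hL' := (hθ _).2 hL
  have hxL : x ∈ panelLine 𝔅 i C := mem_panelLine hC
  -- All chambers of the panel other than `C` are opposite `θ x`.
  have hgen : ∀ {z : 𝔅.Point}, R.pointRoot C z = simpleRoot i - R.h → ∀ {D : Δ},
      𝔅.δ C D = M.simple i → R.pointRoot D z = -R.h := by
    intro z hz D hD
    have hform : form M (R.pointRoot C z) (simpleRoot i) = 1 := by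
      rw [hz, map_sub, LinearMap.sub_apply, form_simpleRoot_self, hi1]; norm_num
    rw [R.pointRoot_adjacent_of_nonneg hD (by rw [hform]; norm_num), hform, hz]
    module
  obtain ⟨D₁, D₂, hne, hD₁, hD₂⟩ := hthick C i
  by_cases hij : i = j
  -- If i = j, then θy is opposite x for a point y ≠ x of L. This forces the root of x seen from the
  -- panel of θL to be α_k - h, and L and θL are opposite.
  · subst hij
    have hyL : face 𝔅 _ D₁ ∈ panelLine 𝔅 i C := mem_panelLine_of_adjacent hD₁ (mem_face D₁)
    have hxy : R.pos (θ (face 𝔅 _ D₁)) x = -2 := by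
      rw [R.pos_comm, ← R.pos_symm_apply hθ, R.pos_comm, R.pos_eq (mem_face D₁), hgen e₂ hD₁,
        map_neg, R.form_h_self]
    obtain ⟨k, hk, E, hE, hEL⟩ := exists_eq_panelLine_of_mem hL' (Set.mem_image_of_mem θ hxL)
    have hyL' := Set.mem_image_of_mem θ hyL
    rw [hEL] at hyL'
    obtain ⟨E', hE', hEE'⟩ := exists_adjacent_of_mem_panelLine hE hyL' (by
      intro heq; rw [heq, R.pos_comm, h] at hxy; omega)
    have hr := R.pointRoot_of_pos_eq_neg_two hxy hE'
    have hEx : R.pointRoot E x = simpleRoot k - R.h := by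
      rcases R.pointRoot_adjacent (𝔅.adjacent_symm hEE') x with h1 | h1
      · rw [h1, hr, map_neg, LinearMap.neg_apply, R.mem_polarType.1 hk]; module
      · rw [hr] at h1
        rw [R.pos_comm, R.pos_eq hE, h1, map_neg, R.form_h_self] at h
        omega
    refine hline _ hL ?_
    rw [hEL]
    refine R.oppositeLines_panelLine hi hk ?_ ?_
    · rw [← R.pointRoot_eq hE, e₁]
    · rw [← R.pointRoot_eq hC, hEx]
  -- If i ≠ j, the pairing of α_j - h with α_i is at most -1, so crossing to E raises the position
  -- to θ⁻¹x from -1 to at least 0. A third chamber D of the thick panel then gives the point y.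
  · have hij0 := form_simpleRoot_nonpos (M := M) hij
    have hform : form M (R.pointRoot C (θ.symm x)) (simpleRoot i) ≤ -1 := by
      rw [e₂, map_sub, LinearMap.sub_apply, hi1, form_comm]; omega
    obtain ⟨E, hCE, hE⟩ := R.exists_pointRoot_adjacent C i (θ.symm x)
    obtain ⟨D, hCD, hDE⟩ : ∃ D, 𝔅.δ C D = M.simple i ∧ D ≠ E := by
      by_cases h1 : D₁ = E
      · exact ⟨D₂, hD₂, fun h2 => hne (h1.trans h2.symm)⟩
      · exact ⟨D₁, hD₁, h1⟩
    have hED := δ_eq_simple_of_adjacent hCE hCD (Ne.symm hDE)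
    set e := face 𝔅 (polarType M) E
    set y := face 𝔅 (polarType M) D
    have heL : e ∈ panelLine 𝔅 i C := mem_panelLine_of_adjacent hCE (mem_face E)
    have hyL : y ∈ panelLine 𝔅 i C := mem_panelLine_of_adjacent hCD (mem_face D)
    have hex : 0 ≤ R.pos (θ e) x := by
      rw [R.pos_comm, ← R.pos_symm_apply hθ, R.pos_comm, R.pos_eq (mem_face E), hE, map_sub,
        map_smul, ← R.pos_eq hC, h', hi1, smul_eq_mul]
      omega
    have hyx : R.pos y (θ x) = -2 := by
      rw [R.pos_eq (mem_face D), hgen e₁ hCD, map_neg, R.form_h_self]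
    have hxy : Collinear 𝔅.lines y x :=
      ⟨fun hyx => R.notMem_of_adjacent hi hCD hC (hyx ▸ mem_face D), _, hL, hyL, hxL⟩
    have h1 := R.pos_ne_neg_two_of_common_neighbour hex hxy
    have h2 : R.pos y (θ y) ≠ -2 := fun h2 => hpoint y (R.opposite_of_pos_eq_neg_two h2)
    have h3 := R.neg_two_le_pos (θ e) y
    have h4 := R.neg_two_le_pos y (θ y)
    have heq := R.eq_of_pos_lt hL' y (Set.mem_image_of_mem θ hxL) (Set.mem_image_of_mem θ heL)
      (Set.mem_image_of_mem θ hyL) (by rw [R.pos_comm y (θ e)]; omega) (by omega)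
    have hey : e = y := θ.injective heq
    exact R.notMem_of_adjacent hi hED (mem_face E) (by change D ∈ e.1; rw [hey]; exact mem_face D)

/-- A point-domestic and line-domestic collineation maps no point to a collinear one. -/
theorem pos_ne_one [Finite M.Group] (hpoint : IsPointDomestic θ) (hline : IsLineDomestic θ)
    (x : 𝔅.Point) : R.pos x (θ x) ≠ 1 := by
  intro h
  have h' : R.pos x (θ.symm x) = 1 := by rw [R.pos_comm, R.pos_symm_apply hθ, h]
  have hnonneg : ∀ y, 0 ≤ R.pos y (θ y) := by
    intro y
    have h1 := R.pos_ne_neg_one hthick hθ hpoint hline y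
    have h2 : R.pos y (θ y) ≠ -2 := fun h2 => hpoint y (R.opposite_of_pos_eq_neg_two h2)
    have h3 := R.neg_two_le_pos y (θ y)
    omega
  obtain ⟨C, hC, i, hi, j, hj, e₁, e₂⟩ := R.exists_simpleRoot_pair hthick (a := 0) (Or.inl rfl)
    (h.trans (by norm_num)) (h'.trans (by norm_num))
  rw [zero_smul, sub_zero] at e₁ e₂
  have hi1 := R.mem_polarType.1 hi
  have hL := panelLine_mem_lines (𝔅 := 𝔅) hi C
  have hL' := (hθ _).2 hL
  have hxL : x ∈ panelLine 𝔅 i C := mem_panelLine hC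
  have hgen : ∀ {z : 𝔅.Point}, R.pointRoot C z = simpleRoot i → ∀ {D : Δ},
      𝔅.δ C D = M.simple i → R.pos (face 𝔅 _ D) z = -1 := by
    intro z hz D hD
    rw [R.pos_eq (mem_face D), R.pointRoot_adjacent_of_nonneg hD
      (by rw [hz, form_simpleRoot_self]; norm_num), hz, form_simpleRoot_self, map_sub, map_smul,
      hi1]
    norm_num
  obtain ⟨D₁, D₂, hne, hD₁, hD₂⟩ := hthick C i
  set y₁ := face 𝔅 (polarType M) D₁
  set y₂ := face 𝔅 (polarType M) D₂
  have hy₁L : y₁ ∈ panelLine 𝔅 i C := mem_panelLine_of_adjacent hD₁ (mem_face D₁)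
  have hy₂L : y₂ ∈ panelLine 𝔅 i C := mem_panelLine_of_adjacent hD₂ (mem_face D₂)
  have hxy₁ : y₁ ≠ x := fun hyx => R.notMem_of_adjacent hi hD₁ hC (hyx ▸ mem_face D₁)
  by_cases hij : i = j
  -- If i = j, the panel of θL at E sees x as α_k. As x is the centre of the special pair θx, y₁, it
  -- sees y₁ as α_k - h; crossing to θy₁ turns this into -h, so y₁ and θy₁ would be opposite.
  · subst hij
    obtain ⟨k, hk, E, hE, hEL⟩ := exists_eq_panelLine_of_mem hL' (Set.mem_image_of_mem θ hxL)
    have hyL' := Set.mem_image_of_mem θ hy₁L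
    rw [hEL] at hyL'
    obtain ⟨E', hE', hEE'⟩ := exists_adjacent_of_mem_panelLine hE hyL' (θ.injective.ne hxy₁)
    have h1 : R.pos (θ y₁) x = -1 := by
      rw [R.pos_comm, ← R.pos_symm_apply hθ, R.pos_comm, hgen e₂ hD₁]
    have hr := R.isRoot_pointRoot E x
    have hEx : R.pointRoot E x = simpleRoot k := by
      refine R.eq_of_form_eq_two hr (isRoot_simpleRoot k) ?_
      rw [R.pos_eq hE'] at h1
      rw [R.pos_comm, R.pos_eq hE] at h
      rcases R.pointRoot_adjacent hEE' x with h2 | h2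
      · rw [h2, map_sub, map_smul, h, R.mem_polarType.1 hk, smul_eq_mul] at h1
        omega
      · rw [h2, h] at h1
        omega
    have hcentre := R.pointRoot_centre (x := θ x) (y := y₁) (z := x)
      (by rw [R.pos_comm, hgen e₁ hD₁]) (R.collinear_iff.2 (by rw [R.pos_comm, h]))
      ⟨hxy₁, _, hL, hy₁L, hxL⟩ hE
    have hEy : R.pointRoot E y₁ = simpleRoot k - R.h := by
      rw [← hEx, hcentre]; abel
    have hform : form M (R.pointRoot E y₁) (simpleRoot k) = 1 := by
      rw [hEy, map_sub, LinearMap.sub_apply, form_simpleRoot_self, R.mem_polarType.1 hk]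
      norm_num
    have h2 := hnonneg y₁
    rw [R.pos_comm, R.pos_eq hE', R.pointRoot_adjacent_of_nonneg hEE' (by rw [hform]; norm_num),
      hform, hEy, map_sub, map_sub, map_smul, R.form_h_self, R.mem_polarType.1 hk] at h2
    norm_num at h2
  -- If i ≠ j, crossing the panel does not increase the distance to θ⁻¹x. So x and y₁ are both at
  -- position at least 0 from θy₁, and then y₂ is too by the one-exception property. With respect to
  -- y₂, which is special to θx, the line θL would have the exceptions θy₁ and θy₂.
  · have hx₁ : 1 ≤ R.pos x (θ y₁) := by
      rw [← R.pos_symm_apply hθ, R.pos_comm, R.pos_eq (mem_face D₁)]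
      rcases R.pointRoot_adjacent hD₁ (θ.symm x) with h1 | h1
      · have := form_simpleRoot_nonpos (M := M) hij
        rw [h1, map_sub, map_smul, e₂, hi1, R.mem_polarType.1 hj, form_comm, smul_eq_mul]
        omega
      · rw [h1, e₂, R.mem_polarType.1 hj]
    have h21 : 0 ≤ R.pos (θ y₁) y₂ := by
      by_contra hneg
      rw [R.pos_comm] at hx₁
      have := hnonneg y₁
      rw [R.pos_comm] at this
      exact hxy₁ (R.eq_of_pos_lt hL (θ y₁) hy₂L hy₁L hxL (by omega) (by omega))
    have h22 := hnonneg y₂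
    have h2x : R.pos y₂ (θ x) = -1 := hgen e₁ hD₂
    have heq := R.eq_of_pos_lt hL' y₂ (Set.mem_image_of_mem θ hxL) (Set.mem_image_of_mem θ hy₁L)
      (Set.mem_image_of_mem θ hy₂L) (by rw [R.pos_comm y₂ (θ y₁)]; omega) (by omega)
    have hy : y₁ = y₂ := θ.injective heq
    exact R.notMem_of_adjacent hi (δ_eq_simple_of_adjacent hD₁ hD₂ hne) (mem_face D₁)
      (by change D₂ ∈ y₁.1; rw [hy]; exact mem_face D₂)

end Domestic

end HighestRootDatum

end LongRoot

theorem mainTheorem9 {B Δ : Type*} [Fintype B] [DecidableEq B] [Nontrivial B]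
    (M : CoxeterMatrix B) [Finite M.Group]
    (hirr : LongRoot.IsIrreducible M) (hsl : LongRoot.IsSimplyLaced M)
    (𝔅 : LongRoot.Building M Δ) (hthick : 𝔅.IsThick)
    (θ : Equiv.Perm 𝔅.Point) (hθ : LongRoot.IsCollineation 𝔅.lines θ)
    (hpoint : LongRoot.Building.IsPointDomestic θ) (hline : LongRoot.Building.IsLineDomestic θ) :
    LongRoot.IsKangaroo 𝔅.lines {LongRoot.Position.one, LongRoot.Position.twoPrime} θ := by
  intro x d hd hpos
  -- The existence of a highest root need not be proved: a forbidden position supplies a line, a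
  -- line has a polar cotype, and a polar node comes with a highest root.
  obtain ⟨i, h, hh, -⟩ : (LongRoot.polarType M).Nonempty := by
    have hcol : ∃ y z, LongRoot.Collinear 𝔅.lines y z := by
      rcases hd with rfl | rfl
      · exact ⟨_, _, hpos⟩
      · obtain ⟨-, -, r, ⟨hr, -⟩, -⟩ := hpos
        exact ⟨_, _, hr⟩
    obtain ⟨_, _, -, L, ⟨i, hi, -⟩, -⟩ := hcol
    exact ⟨i, hi⟩
  let R : LongRoot.HighestRootDatum M := ⟨hsl, hirr, h, hh⟩
  rcases hd with rfl | rfl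
  · exact R.pos_ne_one hthick hθ hpoint hline x (R.pos_of_collinear hpos)
  · exact R.pos_ne_neg_one hthick hθ hpoint hline x (R.pos_eq_neg_one_of_hasPosition hpos)
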